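/- **Setting.** Let $v:[0,1]\to\mathbb R$ be Lipschitz with $v(0)>0$ and $v(1)>0$, and let $a\ge 0$. For $x_0\in[0,1]$ let $x(\cdot;x_0)$ be the maximal solution in $[0,1]$ of $\dot x=v(x)$, $x(0)=x_0$, with maximal interval of existence $I_{x_0}\subset[0,\infty)$. For $t\ge0$ put $\Phi_t(x_0)=x(t;x_0)$ if $t\in I_{x_0}$ and $\Phi_t(x_0)=1$ otherwise, and let $P_t\mu=\mu\circ\Phi_t^{-1}$ for finite Borel measures $\mu$ on $[0,1]$. Let $\mathcal M([0,1])$ be the finite signed Borel measures on $[0,1]$ and $\mathcal M^+([0,1])$ the positive ones. Let $\mathrm{BL}([0,1])$ be the bounded Lipschitz functions with norm $\|\varphi\|_{\mathrm{BL}}=\|\varphi\|_\infty+|\varphi|_L$, where $|\varphi|_L$ is the Lipschitz constant. Put $\|\nu\|^*_{\mathrm{BL}}=\sup\{|\int\varphi\,d\nu| : \|\varphi\|_{\mathrm{BL}}\le1\}$. The subscript $\mathrm{BL}$ on $\mathcal M$ or $\mathcal M^+$ means that the set carries this norm; $\mathcal M([0,1])$ is regarded as a subspace of the dual space $\mathrm{BL}([0,1])^*$.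 For $n\ge1$ let $f_n(x)=[\,n(x-(1-\tfrac1n))\,]^+$ and $F^{(n)}\mu=-a f_n\,d\mu$. Given $\mu_0\in\mathcal M^+([0,1])$, a mild solution of the $n$-th regularized system is a continuous map $\mu^{(n)}:[0,\infty)\to\mathcal M^+([0,1])_{\mathrm{BL}}$ with $$\mu^{(n)}_t=P_t\mu_0+\int_0^tP_{t-s}F^{(n)}\mu^{(n)}_s\,ds\qquad(t\ge0)$$ (a Bochner integral in $\mathrm{BL}([0,1])^*$), and a mild solution of the limit equation is a continuous map $\mu:[0,\infty)\to\mathcal M([0,1])_{\mathrm{BL}}$ with $$\mu_t=P_t\mu_0-a\int_0^t\mu_s(\{1\})\,ds\cdot\delta_1\qquad(t\ge0).$$ **Theorem 4.8.** Let $\lambda$ be Lebesgue measure on $[0,1]$, and let $\mu_0\in\mathcal M^+([0,1])$ have Lebesgue decomposition $\mu_0=\mu_{0,s}+g_0\,d\lambda$, with $\mu_{0,s}$ singular with respect to $\lambda$. Suppose that $g_0\in L^\infty([0,1])$ and that, with $E_m=[1-\tfrac1m,1)$, $$\frac{P_s\mu_{0,s}(E_m)}{\lambda(E_m)}\to0\quad(m\to\infty)\qquad\text{for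 $\lambda$-a.e. } s\in[0,1].$$ Then each regularized system ($n\ge1$) has a unique mild solution $\mu^{(n)}$ and the limit equation has a unique mild solution $\mu$. For every $T>0$ the sequence $(\mu^{(n)})_{n\ge1}$ is Cauchy in $C([0,T],\mathcal M^+([0,1])_{\mathrm{BL}})$, and there is a constant $C$ (which may depend on $T$, $v$, $a$, $\mu_0$) such that $$\|\mu^{(n)}_t-\mu_t\|^*_{\mathrm{BL}}\le\frac Cn\qquad\text{for all } n\ge1,\ t\in[0,T],$$ that is, $\|\mu^{(n)}_t-\mu_t\|^*_{\mathrm{BL}}=O(1/n)$ as $n\to\infty$, uniformly on compact time intervals. -/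

import Mathlib

open MeasureTheory Set Filter Topology
open scoped NNReal ENNReal BoundedContinuousFunction unitInterval

namespace StickyBoundary

noncomputable section

/-! ### Bounded Lipschitz functions and the dual bounded Lipschitz norm -/

/-- The bounded Lipschitz functions, as a subspace of the bounded continuous functions. -/
def blSubmodule (S : Type*) [PseudoMetricSpace S] : Submodule ℝ (S →ᵇ ℝ) where
  carrier := {f | ∃ K : ℝ≥0, LipschitzWith K f}
  add_mem' := by
    rintro f g ⟨K, hK⟩ ⟨L, hL⟩
    exact ⟨K + L, hK.add hL⟩
  zero_mem' := ⟨0, LipschitzWith.const 0⟩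
  smul_mem' := by
    rintro c f ⟨K, hK⟩
    refine ⟨‖c‖₊ * K, LipschitzWith.of_dist_le_mul fun x y => ?_⟩
    have h := hK.dist_le_mul x y
    simp only [BoundedContinuousFunction.coe_smul, dist_smul₀, NNReal.coe_mul, coe_nnnorm, mul_assoc]
    gcongr

/-- The space `BL(S)` of real-valued bounded Lipschitz functions on a metric space.
(A separate type, because its norm is not the supremum norm.) -/
def BL (S : Type*) [PseudoMetricSpace S] : Type _ := blSubmodule S

namespace BL

variable {S : Type*} [PseudoMetricSpace S]

instance : AddCommGroup (BL S) := inferInstanceAs (AddCommGroup (blSubmodule S))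

instance : Module ℝ (BL S) := inferInstanceAs (Module ℝ (blSubmodule S))

/-- The underlying bounded continuous function. -/
def toBCF (f : BL S) : S →ᵇ ℝ := f.1

instance : CoeFun (BL S) (fun _ => S → ℝ) := ⟨fun f => f.toBCF⟩

/-- The Lipschitz constant `|f|_L`: the supremum of `|f x - f y| / d(x, y)` over `x ≠ y`
(pairs at distance `0` contribute `0`). -/
def lipConst (f : BL S) : ℝ := ⨆ p : S × S, |f p.1 - f p.2| / dist p.1 p.2

theorem bddAbove_quot (f : BL S) :
    BddAbove (range fun p : S × S => |f p.1 - f p.2| / dist p.1 p.2) := by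
  obtain ⟨K, hK⟩ := f.2
  refine ⟨K, ?_⟩
  rintro _ ⟨p, rfl⟩
  exact div_le_of_le_mul₀ dist_nonneg K.2 (hK.dist_le_mul p.1 p.2)

theorem quot_le (f : BL S) (p : S × S) : |f p.1 - f p.2| / dist p.1 p.2 ≤ f.lipConst :=
  le_ciSup f.bddAbove_quot p

theorem lipConst_nonneg (f : BL S) : 0 ≤ f.lipConst :=
  Real.iSup_nonneg fun _ => by positivity

/-- `‖f‖_BL = ‖f‖_∞ + |f|_L`. -/
instance : Norm (BL S) := ⟨fun f => ‖f.toBCF‖ + f.lipConst⟩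

theorem norm_def (f : BL S) : ‖f‖ = ‖f.toBCF‖ + f.lipConst := rfl

theorem core : NormedSpace.Core ℝ (BL S) where
  norm_nonneg f := add_nonneg (norm_nonneg _) f.lipConst_nonneg
  norm_smul c f := by
    have h1 : (c • f).toBCF = c • f.toBCF := rfl
    have h2 : (c • f).lipConst = ‖c‖ * f.lipConst := by
      unfold lipConst
      rw [Real.mul_iSup_of_nonneg (norm_nonneg c)]
      congr 1
      ext p
      rw [h1]
      simp only [BoundedContinuousFunction.coe_smul, smul_eq_mul, ← mul_sub, abs_mul, Real.norm_eq_abs,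
        mul_div_assoc]
    rw [norm_def, norm_def, h1, h2, norm_smul, mul_add]
  norm_triangle f g := by
    have h1 : (f + g).toBCF = f.toBCF + g.toBCF := rfl
    have h2 : (f + g).lipConst ≤ f.lipConst + g.lipConst := by
      refine Real.iSup_le (fun p => ?_) (add_nonneg f.lipConst_nonneg g.lipConst_nonneg)
      refine le_trans ?_ (add_le_add (f.quot_le p) (g.quot_le p))
      rw [← add_div, h1]
      gcongr
      simp only [BoundedContinuousFunction.coe_add, Pi.add_apply]
      rw [add_sub_add_comm]
      exact abs_add_le _ _
    rw [norm_def, norm_def, norm_def, h1]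
    linarith [norm_add_le f.toBCF g.toBCF]
  norm_eq_zero_iff f := by
    constructor
    · intro h
      rw [norm_def] at h
      have h0 : ‖f.toBCF‖ = 0 :=
        le_antisymm (by linarith [f.lipConst_nonneg]) (norm_nonneg _)
      exact Subtype.ext (norm_eq_zero.1 h0)
    · rintro rfl
      have h1 : (0 : BL S).toBCF = 0 := rfl
      rw [norm_def, h1]
      simp [lipConst, h1]

instance : NormedAddCommGroup (BL S) := NormedAddCommGroup.ofCore core

instance : NormedSpace ℝ (BL S) := NormedSpace.ofCore core

end BL

/-- The functional `φ ↦ ∫ φ dμ` on `BL(S)` given by a finite positive measure. Norms in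
`BL(S)*` of (differences of) such functionals are the dual bounded Lipschitz norms `‖·‖*_BL`. -/
def measureFunctional {S : Type*} [PseudoMetricSpace S] [MeasurableSpace S]
    [OpensMeasurableSpace S] (μ : Measure S) [IsFiniteMeasure μ] : StrongDual ℝ (BL S) :=
  LinearMap.mkContinuous
    { toFun := fun f => ∫ x, f x ∂μ
      map_add' := fun f g =>
        integral_add (f.toBCF.integrable μ) (g.toBCF.integrable μ)
      map_smul' := fun c f => integral_const_mul c (fun x => f x) }
    (μ.real univ)
    (fun f => by
      refine (f.toBCF.norm_integral_le_mul_norm μ).trans ?_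
      have := f.lipConst_nonneg
      rw [BL.norm_def]
      gcongr
      linarith)

/-- The functional `φ ↦ ∫ φ dν` on `BL(S)` given by a finite signed measure. -/
def signedFunctional {S : Type*} [PseudoMetricSpace S] [MeasurableSpace S]
    [OpensMeasurableSpace S] (ν : SignedMeasure S) : StrongDual ℝ (BL S) :=
  measureFunctional ν.toJordanDecomposition.posPart -
    measureFunctional ν.toJordanDecomposition.negPart

/-! ### The individualistic flow on `[0,1]` and mass transport -/

/-- `x` solves `x' = v(x)`, `x(0) = x₀` in `[0,1]` on the time interval `[0, T]`. -/
def IsTrajectory (v : I → ℝ) (x₀ : I) (T : ℝ) (x : ℝ → I) : Prop :=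
  x 0 = x₀ ∧ ∀ t ∈ Icc 0 T, HasDerivWithinAt (fun s => (x s : ℝ)) (v (x t)) (Icc 0 T) t

open Classical in
/-- The flow `Φ_t`: the value at time `t` of the solution starting at `x₀` if that solution
exists in `[0,1]` up to time `t`, that is, if `t` lies in its maximal interval of existence,
and `1` otherwise. -/
def flow (v : I → ℝ) (t : ℝ) (x₀ : I) : I :=
  if h : ∃ x, IsTrajectory v x₀ t x then h.choose t else 1

/-- `P_t μ`: the push-forward of `μ` under `Φ_t`. -/
def transport (v : I → ℝ) (t : ℝ) (μ : FiniteMeasure I) : FiniteMeasure I :=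
  μ.map (flow v t)

/-! ### The regularized systems and the limit equation -/

/-- The regularizer `f_n(x) = [n (x - (1 - 1/n))]⁺`. -/
def regularizer (n : ℕ) (x : I) : ℝ := max ((n : ℝ) * ((x : ℝ) - (1 - 1 / (n : ℝ)))) 0

theorem regularizer_le (n : ℕ) (x : I) : regularizer n x ≤ 1 := by
  refine max_le ?_ zero_le_one
  rcases Nat.eq_zero_or_pos n with rfl | hn
  · simp
  · have h : (0 : ℝ) < n := by exact_mod_cast hn
    have hx := x.2.2
    have : (n : ℝ) * ((x : ℝ) - (1 - 1 / (n : ℝ))) = 1 - n * (1 - x) := by field_simp; ring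
    rw [this]
    nlinarith

/-- The measure `f_n · dμ`. -/
def regularize (n : ℕ) (μ : FiniteMeasure I) : FiniteMeasure I :=
  ⟨(μ : Measure I).withDensity fun x => ENNReal.ofReal (regularizer n x),
    isFiniteMeasure_withDensity (by
      refine ne_top_of_le_ne_top (measure_ne_top (μ : Measure I) univ) ?_
      calc ∫⁻ x, ENNReal.ofReal (regularizer n x) ∂(μ : Measure I)
          ≤ ∫⁻ _, 1 ∂(μ : Measure I) := lintegral_mono fun x => by
            simpa using regularizer_le n x
        _ = (μ : Measure I) univ := by simp)⟩

/-- `μ` is a mild solution in `C([0,∞), M⁺([0,1])_BL)` of the `n`-th regularized system,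
`μ_t = P_t μ₀ + ∫₀ᵗ P_{t-s} F⁽ⁿ⁾ μ_s ds` with `F⁽ⁿ⁾ μ = -a f_n · dμ`. The equation is one in
`BL([0,1])*`, and its integral is a Bochner integral there. Only times `t ≥ 0` matter. -/
structure IsRegularizedSolution (v : I → ℝ) (a : ℝ) (n : ℕ) (μ₀ : FiniteMeasure I)
    (μ : ℝ → FiniteMeasure I) : Prop where
  continuousOn : ContinuousOn (fun t => measureFunctional (μ t : Measure I)) (Ici 0)
  integrable : ∀ t, 0 ≤ t → IntervalIntegrable
    (fun s => measureFunctional (transport v (t - s) (regularize n (μ s)) : Measure I))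
    volume 0 t
  equation : ∀ t, 0 ≤ t →
    measureFunctional (μ t : Measure I) =
      measureFunctional (transport v t μ₀ : Measure I) +
        ∫ s in (0 : ℝ)..t,
          (-a) • measureFunctional (transport v (t - s) (regularize n (μ s)) : Measure I)

/-- `μ` is a mild solution in `C([0,∞), M([0,1])_BL)` of the limit equation
`μ_t = P_t μ₀ - a (∫₀ᵗ μ_s({1}) ds) δ₁`. Only times `t ≥ 0` matter. -/
structure IsLimitSolution (v : I → ℝ) (a : ℝ) (μ₀ : FiniteMeasure I)
    (μ : ℝ → SignedMeasure I) : Prop where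
  continuousOn : ContinuousOn (fun t => signedFunctional (μ t)) (Ici 0)
  integrable : ∀ t, 0 ≤ t → IntervalIntegrable (fun s => μ s {1}) volume 0 t
  equation : ∀ t, 0 ≤ t →
    μ t = (transport v t μ₀ : Measure I).toSignedMeasure -
      (a * ∫ s in (0 : ℝ)..t, μ s {1}) • (Measure.dirac (1 : I)).toSignedMeasure

/-- The boundary layer `E_m = [1 - 1/m, 1)`. -/
def layer (m : ℕ) : Set I := {x | 1 - 1 / (m : ℝ) ≤ (x : ℝ) ∧ (x : ℝ) < 1}

/-- The part of `μ` that is singular with respect to Lebesgue measure on `[0,1]`. -/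
def singularPart (μ : FiniteMeasure I) : FiniteMeasure I :=
  ⟨(μ : Measure I).singularPart volume, inferInstance⟩

end

end StickyBoundary

namespace StickyBoundary

/-! ### Global solutions of autonomous Lipschitz equations -/

/-! Both equations have explicit solutions. Killing at rate `a q` along the flow leaves the fraction
`w_t(x) = exp(-a ∫₀ᵗ q(Φ_s x) ds)` of the mass started at `x`, and the solution is `P_t (w_t μ₀)`,
with `q = f_n` or `q` the indicator of `{1}`. The identity `w_t = 1 - a ∫₀ᵗ q(Φ_s) w_s ds`,
integrated against `φ ∘ Φ_t` with Fubini (`integral_killing`) and combined with `flow_add`, is the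
mild equation. In the limit case a particle loses mass only at the absorbing point `1`, so the loss
term is a multiple of `δ₁`.

For fixed `t` the two solutions push `μ₀` forward by the same map, so their distance is at most
`μ₀([0,1])` times the supremum of the difference of the weights, hence governed by `∫₀ᵗ (f_n -
1_{1})(Φ_s x) ds`. Extended to the line, a trajectory crosses `1` with speed at least `v 1 / 2`
nearby, so this integral is `O(1/n)` uniformly in `x` and `t`
(`exists_integral_regularizer_sub_le`).

Uniqueness is Gronwall: in the dual norm for fixed `n`, and for the scalar mass at `1` in the limit.
-/

theorem exists_global_solution {V : ℝ → ℝ} {K M : ℝ≥0} (hV : LipschitzWith K V)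
    (hM : ∀ x, |V x| ≤ M) (x : ℝ) :
    ∃ y : ℝ → ℝ, y 0 = x ∧ ∀ t, HasDerivAt y (V (y t)) t := by
  have hloc : ∀ N : ℕ, ∃ y : ℝ → ℝ, y 0 = x ∧
      ∀ t ∈ Icc (-((N : ℝ) + 1)) (N + 1),
        HasDerivWithinAt y (V (y t)) (Icc (-((N : ℝ) + 1)) (N + 1)) t := by
    intro N
    have h0 : (0 : ℝ) ∈ Icc (-((N : ℝ) + 1)) (N + 1) := ⟨by linarith [N.cast_nonneg (α := ℝ)],
      by positivity⟩
    -- In time `N + 1` a solution moves at most `M * (N + 1)`. With this radius the smallness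
    -- condition holds with equality, so the length of the interval is unrestricted.
    have hP : IsPicardLindelof (fun _ => V) (⟨0, h0⟩ : Icc (-((N : ℝ) + 1)) (N + 1)) x
        (M * (N + 1)) 0 M K :=
      { lipschitzOnWith := fun _ _ => hV.lipschitzOnWith
        continuousOn := fun _ _ => continuousOn_const
        norm_le := fun _ _ z _ => hM z
        mul_max_le := by simp }
    exact hP.exists_eq_forall_mem_Icc_hasDerivWithinAt₀
  choose y hy0 hy using hloc
  have hder : ∀ N : ℕ, ∀ t ∈ Ioo (-((N : ℝ) + 1)) (N + 1), HasDerivAt (y N) (V (y N t)) t :=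
    fun N t ht => (hy N t (Ioo_subset_Icc_self ht)).hasDerivAt (Icc_mem_nhds ht.1 ht.2)
  have hmono : ∀ N L : ℕ, N ≤ L → EqOn (y N) (y L) (Icc (-((N : ℝ) + 1)) (N + 1)) := by
    intro N L hNL
    have hNL' : (N : ℝ) ≤ L := by exact_mod_cast hNL
    have hN : (0 : ℝ) ≤ N := N.cast_nonneg
    refine ODE_solution_unique_of_mem_Icc (v := fun _ => V) (s := fun _ => univ) (t₀ := 0) (K := K)
      (fun _ _ => hV.lipschitzOnWith) ⟨by linarith, by linarith⟩
      (fun t ht => (hy N t ht).continuousWithinAt) (hder N) (fun _ _ => trivial) ?_ ?_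
      (fun _ _ => trivial) (by rw [hy0, hy0])
    · exact ContinuousOn.mono (fun t ht => (hy L t ht).continuousWithinAt)
        (Icc_subset_Icc (by linarith) (by linarith))
    · exact fun t ht => hder L t ⟨by linarith [ht.1], by linarith [ht.2]⟩
  -- The index jumps, but `hmono` makes the local solutions agree. The extra `1` in the windows puts
  -- `t` in the interior of its own window.
  refine ⟨fun t => y ⌈|t|⌉₊ t, hy0 _, fun t => ?_⟩
  set N := ⌈|t|⌉₊ with hN
  have ht : |t| < (N : ℝ) + 1 := (Nat.le_ceil _).trans_lt (lt_add_one _)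
  have hev : (fun s => y ⌈|s|⌉₊ s) =ᶠ[𝓝 t] y N := by
    have h1 : ∀ᶠ s in 𝓝 t, |s| < (N : ℝ) + 1 :=
      (continuous_abs.tendsto t).eventually (gt_mem_nhds ht)
    filter_upwards [h1] with s hs
    rcases le_total ⌈|s|⌉₊ N with h | h
    · have hs' := (Nat.le_ceil |s|).trans (le_add_of_nonneg_right zero_le_one)
      exact hmono _ _ h (abs_le.1 hs')
    · exact (hmono _ _ h (abs_le.1 hs.le)).symm
  exact (hder N t (abs_lt.1 ht)).congr_of_eventuallyEq hev

/-- A level at which the field is positive can only be crossed upwards. -/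
theorem le_solution_of_le {V y : ℝ → ℝ} {l : ℝ} (hl : 0 < V l)
    (hy : ∀ t, HasDerivAt y (V (y t)) t) {s t : ℝ} (hst : s ≤ t) (hs : l ≤ y s) : l ≤ y t :=
  -- The constant `l` is the lower function and `y` the barrier: at a contact the slope `0` is less
  -- than `V l`.
  image_le_of_deriv_right_lt_deriv_boundary (f := fun _ => l) (f' := fun _ => 0)
    continuousOn_const (fun _ _ => hasDerivWithinAt_const _ _ _) hs hy
    (fun r _ hr => by rw [← hr]; exact hl) ⟨hst, le_rfl⟩

/-! ### The flow as a truncated flow on the line -/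

/-- The extension of a field on `[0,1]` that is constant on both sides. -/
noncomputable def extendedField (v : I → ℝ) : ℝ → ℝ := IccExtend zero_le_one v

theorem extendedField_coe (v : I → ℝ) (x : I) : extendedField v x = v x := IccExtend_val _ _ _

theorem extendedField_of_one_le (v : I → ℝ) {x : ℝ} (hx : 1 ≤ x) : extendedField v x = v 1 :=
  IccExtend_of_right_le _ _ hx

theorem lipschitzWith_extendedField {v : I → ℝ} {K : ℝ≥0} (hv : LipschitzWith K v) :
    LipschitzWith K (extendedField v) := by
  have := hv.comp (LipschitzWith.projIcc (zero_le_one (α := ℝ)))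
  rwa [mul_one] at this

theorem exists_bound_field {v : I → ℝ} (hv : Continuous v) : ∃ M : ℝ≥0, ∀ x, |v x| ≤ M := by
  obtain ⟨M, hM⟩ := isCompact_univ.exists_bound_of_continuousOn hv.continuousOn
  exact ⟨M.toNNReal, fun x => (hM x trivial).trans (Real.le_coe_toNNReal M)⟩

/-- `Ψ t x` is the solution on the line, started at `x ∈ [0,1]`. -/
structure IsLineFlow (v : I → ℝ) (Ψ : ℝ → I → ℝ) : Prop where
  zero : ∀ x, Ψ 0 x = x
  deriv : ∀ x t, HasDerivAt (fun s => Ψ s x) (extendedField v (Ψ t x)) t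

theorem exists_isLineFlow {v : I → ℝ} {K : ℝ≥0} (hv : LipschitzWith K v) :
    ∃ Ψ, IsLineFlow v Ψ := by
  obtain ⟨M, hM⟩ := exists_bound_field hv.continuous
  choose Ψ h0 h1 using fun x : I => exists_global_solution (lipschitzWith_extendedField hv)
    (fun z => hM (projIcc 0 1 zero_le_one z)) (x : ℝ)
  exact ⟨fun t x => Ψ x t, h0, h1⟩

namespace IsLineFlow

variable {v : I → ℝ} {Ψ : ℝ → I → ℝ} {K : ℝ≥0}

theorem continuous_time (h : IsLineFlow v Ψ) (x : I) : Continuous fun t => Ψ t x :=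
  continuous_iff_continuousAt.2 fun t => (h.deriv x t).continuousAt

theorem nonneg (h : IsLineFlow v Ψ) (hv0 : 0 < v 0) {t : ℝ} (ht : 0 ≤ t) (x : I) :
    0 ≤ Ψ t x :=
  le_solution_of_le (V := extendedField v) (by simpa using (extendedField_coe v 0).symm ▸ hv0)
    (h.deriv x) ht (by simpa only [h.zero] using x.2.1)

theorem le_of_one_le (h : IsLineFlow v Ψ) (hv1 : 0 < v 1) {s t : ℝ} (hst : s ≤ t) {x : I}
    (hs : 1 ≤ Ψ s x) : 1 ≤ Ψ t x :=
  le_solution_of_le (V := extendedField v) (by rwa [extendedField_of_one_le v le_rfl])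
    (h.deriv x) hst hs

theorem dist_le (h : IsLineFlow v Ψ) (hv : LipschitzWith K v) {t : ℝ} (ht : 0 ≤ t) (x y : I) :
    dist (Ψ t x) (Ψ t y) ≤ dist x y * Real.exp (K * t) := by
  have := dist_le_of_trajectories_ODE (v := fun _ => extendedField v)
    (f := fun s => Ψ s x) (g := fun s => Ψ s y) (a := 0) (b := t)
    (fun _ => lipschitzWith_extendedField hv) (h.continuous_time x).continuousOn
    (fun s _ => (h.deriv x s).hasDerivWithinAt) (h.continuous_time y).continuousOn
    (fun s _ => (h.deriv y s).hasDerivWithinAt) (δ := dist x y)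
    (by rw [h.zero, h.zero]; exact le_rfl) t ⟨ht, le_rfl⟩
  simpa using this

/-- Semigroup law, as long as the solution has not left the interval. -/
theorem add (h : IsLineFlow v Ψ) (hv : LipschitzWith K v) (s t : ℝ) {x y : I} (hy : Ψ s x = y) :
    Ψ (t + s) x = Ψ t y := by
  have := ODE_solution_unique_univ (v := fun _ => extendedField v) (s := fun _ => univ) (K := K)
    (f := fun r => Ψ (r + s) x) (g := fun r => Ψ r y) (t₀ := 0)
    (fun _ => (lipschitzWith_extendedField hv).lipschitzOnWith)
    (fun r => ⟨(h.deriv x (r + s)).comp_add_const r s, trivial⟩)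
    (fun r => ⟨h.deriv y r, trivial⟩) (by simp [hy, h.zero])
  exact congrFun this t

theorem eqOn_of_isTrajectory (h : IsLineFlow v Ψ) (hv : LipschitzWith K v) {x₀ : I} {T : ℝ}
    {x : ℝ → I} (hx : IsTrajectory v x₀ T x) : EqOn (fun s => Ψ s x₀) (fun s => (x s : ℝ)) (Icc 0 T) := by
  refine ODE_solution_unique (v := fun _ => extendedField v) (K := K)
    (fun _ => lipschitzWith_extendedField hv) (h.continuous_time x₀).continuousOn
    (fun s _ => (h.deriv x₀ s).hasDerivWithinAt) (fun s hs => (hx.2 s hs).continuousWithinAt) ?_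
    (by simp [h.zero, hx.1])
  intro s hs
  rw [extendedField_coe]
  exact (hx.2 s (Ico_subset_Icc_self hs)).mono_of_mem_nhdsWithin (Icc_mem_nhdsGE_of_mem hs)

/-- Truncation is correct because `v 0 > 0` keeps the line solution nonnegative and `v 1 > 0` makes
passing `1` irreversible. A value below `1` at time `t` therefore means that the whole path up to
`t` stays in `[0,1]` and is a trajectory. -/
theorem flow_eq (h : IsLineFlow v Ψ) (hv : LipschitzWith K v) (hv0 : 0 < v 0) (hv1 : 0 < v 1)
    {t : ℝ} (ht : 0 ≤ t) (x : I) : flow v t x = projIcc 0 1 zero_le_one (Ψ t x) := by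
  unfold flow
  split_ifs with hx
  · have := h.eqOn_of_isTrajectory hv hx.choose_spec (right_mem_Icc.2 ht)
    simp only at this
    rw [this, projIcc_val]
  · by_cases h1 : 1 ≤ Ψ t x
    · exact (projIcc_of_right_le _ h1).symm
    · refine absurd ⟨fun s => projIcc 0 1 zero_le_one (Ψ s x), ?_, ?_⟩ hx
      · simp only [h.zero, projIcc_val]
      · have hcoe : ∀ s ∈ Icc 0 t, ((projIcc 0 1 zero_le_one (Ψ s x) : I) : ℝ) = Ψ s x := by
          intro s hs
          rw [projIcc_of_mem zero_le_one ⟨h.nonneg hv0 hs.1 x, ?_⟩]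
          exact (not_le.1 fun h2 => h1 (h.le_of_one_le hv1 hs.2 h2)).le
        intro s hs
        rw [← extendedField_coe v, hcoe s hs]
        exact (h.deriv x s).hasDerivWithinAt.congr hcoe (hcoe s hs)

end IsLineFlow

/-! ### Semigroup law and regularity of the truncated flow. -/

section Flow

variable {v : I → ℝ} {K : ℝ≥0}

/-- Truncation preserves the semigroup law because `1` is absorbing. -/
theorem flow_add (hv : LipschitzWith K v) (hv0 : 0 < v 0) (hv1 : 0 < v 1) {s t : ℝ}
    (hs : 0 ≤ s) (ht : 0 ≤ t) (x : I) : flow v t (flow v s x) = flow v (t + s) x := by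
  obtain ⟨Ψ, h⟩ := exists_isLineFlow hv
  rw [h.flow_eq hv hv0 hv1 hs, h.flow_eq hv hv0 hv1 ht, h.flow_eq hv hv0 hv1 (add_nonneg ht hs)]
  rcases le_total (Ψ s x) 1 with h1 | h1
  · rw [← h.add hv s t (y := projIcc 0 1 zero_le_one (Ψ s x))]
    rw [projIcc_of_mem zero_le_one ⟨h.nonneg hv0 hs x, h1⟩]
  · rw [projIcc_of_right_le _ h1,
      projIcc_of_right_le _ (h.le_of_one_le hv1 (le_add_of_nonneg_left ht) h1)]
    exact projIcc_of_right_le _ (h.le_of_one_le hv1 ht (by rw [h.zero]))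

theorem flow_eq_one_of_le (hv : LipschitzWith K v) (hv0 : 0 < v 0) (hv1 : 0 < v 1) {s t : ℝ}
    (hs : 0 ≤ s) (hst : s ≤ t) {x : I} (hx : flow v s x = 1) : flow v t x = 1 := by
  obtain ⟨Ψ, h⟩ := exists_isLineFlow hv
  rw [h.flow_eq hv hv0 hv1 hs] at hx
  rw [h.flow_eq hv hv0 hv1 (hs.trans hst)]
  exact projIcc_of_right_le _ (h.le_of_one_le hv1 hst ((projIcc_eq_right zero_lt_one).1 hx))

theorem flow_dist_le (hv : LipschitzWith K v) (hv0 : 0 < v 0) (hv1 : 0 < v 1) {t : ℝ}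
    (ht : 0 ≤ t) (x y : I) : dist (flow v t x) (flow v t y) ≤ Real.exp (K * t) * dist x y := by
  obtain ⟨Ψ, h⟩ := exists_isLineFlow hv
  rw [h.flow_eq hv hv0 hv1 ht, h.flow_eq hv hv0 hv1 ht, mul_comm]
  refine le_trans ?_ (h.dist_le hv ht x y)
  simpa using (LipschitzWith.projIcc (zero_le_one (α := ℝ))).dist_le_mul (Ψ t x) (Ψ t y)

/-- The flow is Lipschitz in time, uniformly in the starting point. -/
theorem exists_lipschitzWith_flow_time (hv : LipschitzWith K v) (hv0 : 0 < v 0) (hv1 : 0 < v 1) :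
    ∃ M : ℝ≥0, ∀ x, LipschitzWith M fun t => flow v (max t 0) x := by
  obtain ⟨Ψ, h⟩ := exists_isLineFlow hv
  obtain ⟨M, hM⟩ := exists_bound_field hv.continuous
  refine ⟨M, fun x => ?_⟩
  have h1 : LipschitzWith M fun t => Ψ t x :=
    lipschitzWith_of_nnnorm_deriv_le (fun t => (h.deriv x t).differentiableAt) fun t => by
      rw [(h.deriv x t).deriv]
      exact hM (projIcc 0 1 zero_le_one _)
  have h2 := (LipschitzWith.projIcc (zero_le_one (α := ℝ))).comp
    (h1.comp (LipschitzWith.id.max_const 0))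
  rw [one_mul, mul_one] at h2
  convert h2 using 2 with t
  exact h.flow_eq hv hv0 hv1 (le_max_right _ _) x

/-- For `t < 0` the interval `Icc 0 t` is empty and `flow` is an arbitrary choice. Clamping time at
`0` gives a map that is well behaved on all of `ℝ × I`. -/
theorem continuous_flow (hv : LipschitzWith K v) (hv0 : 0 < v 0) (hv1 : 0 < v 1) :
    Continuous fun p : ℝ × I => flow v (max p.1 0) p.2 := by
  obtain ⟨M, hM⟩ := exists_lipschitzWith_flow_time hv hv0 hv1
  refine continuous_prod_of_continuous_lipschitzWith _ M (fun t => ?_) hM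
  exact (LipschitzWith.of_dist_le_mul (K := ⟨_, (Real.exp_pos (K * max t 0)).le⟩)
    fun x y => flow_dist_le hv hv0 hv1 (le_max_right _ _) x y).continuous

end Flow

end StickyBoundary

namespace StickyBoundary

/-! ### Time spent in the boundary layer -/

/-- The indicator function of the boundary point `1`. -/
noncomputable def boundaryIndicator : I → ℝ := ({1} : Set I).indicator 1

theorem boundaryIndicator_one : boundaryIndicator 1 = 1 := by simp [boundaryIndicator]

theorem boundaryIndicator_of_ne {x : I} (hx : x ≠ 1) : boundaryIndicator x = 0 := by
  simp [boundaryIndicator, hx]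

theorem measurable_boundaryIndicator : Measurable boundaryIndicator :=
  measurable_one.indicator (measurableSet_singleton 1)

theorem boundaryIndicator_mem (x : I) : boundaryIndicator x ∈ Icc (0 : ℝ) 1 := by
  by_cases hx : x = 1
  · simp [hx, boundaryIndicator_one]
  · simp [boundaryIndicator_of_ne hx]

theorem regularizer_mem (n : ℕ) (x : I) : regularizer n x ∈ Icc (0 : ℝ) 1 :=
  ⟨le_max_right _ _, regularizer_le n x⟩

theorem lipschitzWith_regularizer (n : ℕ) : LipschitzWith n (regularizer n) := by
  refine LipschitzWith.max_const (LipschitzWith.of_dist_le_mul fun x y => ?_) 0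
  rw [Real.dist_eq, ← mul_sub, abs_mul, Nat.abs_cast, Subtype.dist_eq, Real.dist_eq]
  simp

theorem regularizer_one {n : ℕ} (hn : 1 ≤ n) : regularizer n 1 = 1 := by
  have : (n : ℝ) ≠ 0 := by positivity
  simp [regularizer, this]

/-- The tent of height `1` and half-width `1/n` around `1`. -/
noncomputable def tent (n : ℕ) (z : ℝ) : ℝ := max (1 - n * |z - 1|) 0

theorem continuous_tent (n : ℕ) : Continuous (tent n) := by unfold tent; fun_prop

/-- The even extension past `1` is continuous, so it can be integrated by substitution along line
solutions, which cross `1` instead of stopping there. -/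
theorem regularizer_eq_tent {n : ℕ} (hn : 1 ≤ n) (x : I) : regularizer n x = tent n x := by
  have h : (n : ℝ) ≠ 0 := by positivity
  have hx := x.2.2
  rw [regularizer, tent, abs_of_nonpos (by linarith)]
  congr 1
  field_simp
  ring

theorem tent_of_le {n : ℕ} (hn : 1 ≤ n) {z : ℝ} (hz : 1 / (n : ℝ) ≤ |z - 1|) : tent n z = 0 := by
  have h : (0 : ℝ) < n := by positivity
  refine max_eq_right ?_
  rw [div_le_iff₀ h] at hz
  linarith

/-- A box of height `1` and width `2/n` dominates the tent. The endpoints will be positions of a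
line solution, so they are left unordered. -/
theorem integral_tent_le {n : ℕ} (hn : 1 ≤ n) (a b : ℝ) : ∫ z in a..b, tent n z ≤ 2 / n := by
  have hn' : (0 : ℝ) < n := by positivity
  have h0 : ∀ z, 0 ≤ tent n z := fun z => le_max_right _ _
  rcases le_total b a with hab | hab
  · rw [intervalIntegral.integral_symm]
    have := intervalIntegral.integral_nonneg (μ := volume) hab fun z _ => h0 z
    have : (0 : ℝ) ≤ 2 / n := by positivity
    linarith
  · have hle : ∀ z, tent n z ≤ (Icc (1 - 1 / (n : ℝ)) (1 + 1 / n)).indicator 1 z := by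
      intro z
      by_cases hz : z ∈ Icc (1 - 1 / (n : ℝ)) (1 + 1 / n)
      · rw [indicator_of_mem hz]
        exact max_le (sub_le_self _ (by positivity)) zero_le_one
      · rw [indicator_of_notMem hz, tent_of_le hn]
        by_contra hlt
        obtain ⟨h1, h2⟩ := abs_lt.1 (not_le.1 hlt)
        exact hz ⟨by linarith, by linarith⟩
    have hint : Integrable ((Icc (1 - 1 / (n : ℝ)) (1 + 1 / n)).indicator (1 : ℝ → ℝ)) volume :=
      (integrable_indicator_iff measurableSet_Icc).2
        (integrableOn_const (C := (1 : ℝ)) (by simp) (by simp))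
    calc ∫ z in a..b, tent n z ≤
        ∫ z in a..b, (Icc (1 - 1 / (n : ℝ)) (1 + 1 / n)).indicator 1 z :=
          intervalIntegral.integral_mono hab ((continuous_tent n).intervalIntegrable _ _)
            hint.intervalIntegrable hle
      _ ≤ ∫ z, (Icc (1 - 1 / (n : ℝ)) (1 + 1 / n)).indicator 1 z := by
          rw [intervalIntegral.integral_of_le hab]
          exact setIntegral_le_integral hint
            (Eventually.of_forall fun z => indicator_nonneg (fun _ _ => zero_le_one) z)
      _ = 2 / n := by
          rw [integral_indicator_one measurableSet_Icc, Measure.real, Real.volume_Icc,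
            ENNReal.toReal_ofReal (by ring_nf; positivity)]
          ring

variable {v : I → ℝ} {K : ℝ≥0}

/-- Substitute `z = Ψ s x`: the speed is at least `c` wherever the tent is nonzero, so `c` times the
time integral is at most the space integral of the tent. -/
theorem IsLineFlow.integral_tent_le {Ψ : ℝ → I → ℝ} (h : IsLineFlow v Ψ) (hv : LipschitzWith K v)
    {n : ℕ} (hn : 1 ≤ n) {c : ℝ} (hc : 0 < c)
    (hvc : ∀ z, |z - 1| < 1 / (n : ℝ) → c ≤ extendedField v z) {t : ℝ} (ht : 0 ≤ t) (x : I) :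
    ∫ s in (0 : ℝ)..t, tent n (Ψ s x) ≤ 2 / n / c := by
  have hcont : Continuous fun s => extendedField v (Ψ s x) :=
    (lipschitzWith_extendedField hv).continuous.comp (h.continuous_time x)
  have hcont' := (continuous_tent n).comp (h.continuous_time x)
  have hsub := intervalIntegral.integral_comp_mul_deriv (a := 0) (b := t)
    (fun s _ => h.deriv x s) hcont.continuousOn (continuous_tent n)
  rw [le_div_iff₀ hc, ← intervalIntegral.integral_mul_const]
  refine le_trans ?_ (hsub.trans_le (StickyBoundary.integral_tent_le hn _ _))
  refine intervalIntegral.integral_mono ht ((hcont'.mul_const c).intervalIntegrable _ _)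
    ((hcont'.mul hcont).intervalIntegrable _ _) fun s => ?_
  rcases lt_or_ge |Ψ s x - 1| (1 / (n : ℝ)) with hz | hz
  · exact mul_le_mul_of_nonneg_left (hvc _ hz) (le_max_right _ _)
  · simp [tent_of_le hn hz]

/-- The regularizer and the boundary indicator differ along trajectories only for a time
`O(1/n)`. -/
theorem exists_integral_regularizer_sub_le (hv : LipschitzWith K v) (hv0 : 0 < v 0)
    (hv1 : 0 < v 1) :
    ∃ (D : ℝ) (N : ℕ), 0 ≤ D ∧ 1 ≤ N ∧ ∀ n ≥ N, ∀ t, 0 ≤ t → ∀ x,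
      |∫ s in (0 : ℝ)..t, (regularizer n (flow v s x) - boundaryIndicator (flow v s x))|
        ≤ D / n := by
  obtain ⟨Ψ, h⟩ := exists_isLineFlow hv
  have hcont := (lipschitzWith_extendedField hv).continuous
  have h1 : v 1 / 2 < extendedField v 1 := by
    rw [extendedField_of_one_le v le_rfl]; linarith
  obtain ⟨δ, hδ, hδ'⟩ := Metric.eventually_nhds_iff.1
    ((hcont.tendsto 1).eventually (lt_mem_nhds h1))
  obtain ⟨N, hN⟩ := exists_nat_one_div_lt hδ
  -- For `n > N` the field exceeds `v 1 / 2` throughout the tent's support; `2 / n` bounds the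
  -- tent's area.
  refine ⟨2 / (v 1 / 2), N + 1, by positivity, Nat.le_add_left _ _, fun n hn t ht x => ?_⟩
  have hn1 : 1 ≤ n := (Nat.le_add_left _ _).trans hn
  have hnδ : 1 / (n : ℝ) < δ := lt_of_le_of_lt (by
    have : ((N : ℝ) + 1) ≤ n := by exact_mod_cast hn
    gcongr) hN
  have hT := h.integral_tent_le hv hn1 (half_pos hv1)
    (fun z hz => (hδ' (show dist z 1 < δ from hz.trans hnδ)).le) ht x
  rw [div_right_comm] at hT
  refine le_trans ?_ hT
  rw [← Real.norm_eq_abs]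
  refine intervalIntegral.norm_integral_le_of_norm_le (μ := volume) ht (Eventually.of_forall fun s hs => ?_)
    (((continuous_tent n).comp (h.continuous_time x)).intervalIntegrable _ _)
  rw [h.flow_eq hv hv0 hv1 hs.1.le]
  -- Before arrival the indicator vanishes and the difference is the tent; after arrival both
  -- functions equal `1`.
  rcases lt_or_ge (Ψ s x) 1 with hs1 | hs1
  · have hm : Ψ s x ∈ Icc (0 : ℝ) 1 := ⟨h.nonneg hv0 hs.1.le x, hs1.le⟩
    rw [projIcc_of_mem _ hm, boundaryIndicator_of_ne (fun he => hs1.ne (congrArg Subtype.val he)),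
      sub_zero, regularizer_eq_tent hn1, Real.norm_of_nonneg (show 0 ≤ tent n (Ψ s x) from le_max_right _ _)]
  · rw [projIcc_of_right_le _ hs1]
    change ‖regularizer n 1 - boundaryIndicator 1‖ ≤ _
    rw [regularizer_one hn1, boundaryIndicator_one, sub_self, norm_zero]
    exact le_max_right _ _

theorem tendsto_regularizer (x : I) :
    Tendsto (fun n => regularizer n x) atTop (𝓝 (boundaryIndicator x)) := by
  refine tendsto_const_nhds.congr' ?_
  by_cases hx : x = 1
  · filter_upwards [eventually_ge_atTop 1] with n hn
    rw [hx, regularizer_one hn, boundaryIndicator_one]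
  · have hlt : (x : ℝ) < 1 := lt_of_le_of_ne x.2.2 fun he => hx (Subtype.ext he)
    obtain ⟨N, hN⟩ := exists_nat_one_div_lt (sub_pos.2 hlt)
    filter_upwards [eventually_ge_atTop (N + 1)] with n hn
    have hNn : ((N : ℝ) + 1) ≤ n := by exact_mod_cast hn
    rw [boundaryIndicator_of_ne hx, regularizer_eq_tent ((Nat.le_add_left _ _).trans hn), tent_of_le
      ((Nat.le_add_left _ _).trans hn)]
    rw [abs_sub_comm, abs_of_pos (sub_pos.2 hlt)]
    exact le_trans (by gcongr) hN.le

/-! ### Survival weights -/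

/-- The probability that a particle started at `x` and killed at rate `a q` is alive at time `t`. -/
noncomputable def survival (v : I → ℝ) (a : ℝ) (q : I → ℝ) (t : ℝ) (x : I) : ℝ :=
  Real.exp (-a * ∫ s in (0 : ℝ)..t, q (flow v (max s 0) x))

section Survival

variable {a : ℝ} {q : I → ℝ}

theorem survival_pos (t : ℝ) (x : I) : 0 < survival v a q t x := Real.exp_pos _

theorem measurable_rate (hv : LipschitzWith K v) (hv0 : 0 < v 0) (hv1 : 0 < v 1)
    (hq : Measurable q) : Measurable fun p : ℝ × I => q (flow v (max p.1 0) p.2) :=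
  hq.comp (continuous_flow hv hv0 hv1).measurable

theorem intervalIntegrable_rate (hv : LipschitzWith K v) (hv0 : 0 < v 0) (hv1 : 0 < v 1)
    (hq : Measurable q) (hq1 : ∀ x, q x ∈ Icc (0 : ℝ) 1) (x : I) (s t : ℝ) :
    IntervalIntegrable (fun r => q (flow v (max r 0) x)) volume s t := by
  refine (intervalIntegrable_const (c := (1 : ℝ))).mono_fun
    ((measurable_rate hv hv0 hv1 hq).comp
      measurable_prodMk_right).aestronglyMeasurable (Eventually.of_forall fun r => ?_)
  simpa [abs_of_nonneg (hq1 _).1] using (hq1 _).2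

theorem survival_le_one (ha : 0 ≤ a) (hq1 : ∀ x, q x ∈ Icc (0 : ℝ) 1) {t : ℝ} (ht : 0 ≤ t)
    (x : I) : survival v a q t x ≤ 1 := by
  refine Real.exp_le_one_iff.2 ?_
  have := intervalIntegral.integral_nonneg (μ := volume) ht
    fun s _ => (hq1 (flow v (max s 0) x)).1
  nlinarith

theorem measurable_survival (hv : LipschitzWith K v) (hv0 : 0 < v 0) (hv1 : 0 < v 1)
    (hq : Measurable q) : Measurable fun p : ℝ × I => survival v a q (max p.1 0) p.2 := by
  refine Real.measurable_exp.comp (Measurable.const_mul ?_ _)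
  -- Moving the variable endpoint into an indicator gives an integral over a fixed space with
  -- jointly measurable integrand.
  have h1 : ∀ p : ℝ × I, (∫ s in (0 : ℝ)..max p.1 0, q (flow v (max s 0) p.2)) =
      ∫ s, {s | 0 < s ∧ s ≤ p.1}.indicator (fun s => q (flow v (max s 0) p.2)) s := by
    intro p
    rw [intervalIntegral.integral_of_le (le_max_right _ _), ← integral_indicator measurableSet_Ioc]
    have hset : Ioc 0 (max p.1 0) = {s | 0 < s ∧ s ≤ p.1} := by
      ext s
      rw [mem_Ioc, le_max_iff]
      exact ⟨fun h => ⟨h.1, h.2.resolve_right (not_le.2 h.1)⟩, fun h => ⟨h.1, Or.inl h.2⟩⟩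
    rw [hset]
  simp_rw [h1]
  refine (StronglyMeasurable.integral_prod_right (ν := (volume : Measure ℝ))
    (f := fun (p : ℝ × I) s =>
      {s | 0 < s ∧ s ≤ p.1}.indicator (fun s => q (flow v (max s 0) p.2)) s) ?_).measurable
  refine Measurable.stronglyMeasurable ?_
  have hS : MeasurableSet {z : (ℝ × I) × ℝ | 0 < z.2 ∧ z.2 ≤ z.1.1} :=
    (measurableSet_lt measurable_const measurable_snd).inter
      (measurableSet_le measurable_snd (measurable_fst.comp measurable_fst))
  exact ((measurable_rate hv hv0 hv1 hq).comp
    (measurable_snd.prodMk (measurable_snd.comp measurable_fst))).indicator hS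

theorem abs_exp_neg_sub_le {x y : ℝ} (hx : 0 ≤ x) (hy : 0 ≤ y) :
    |Real.exp (-x) - Real.exp (-y)| ≤ |x - y| := by
  wlog hxy : x ≤ y generalizing x y
  · rw [abs_sub_comm, abs_sub_comm x]
    exact this hy hx (le_of_not_ge hxy)
  · have h1 : Real.exp (-y) = Real.exp (-x) * Real.exp (x - y) := by
      rw [← Real.exp_add]; ring_nf
    have h2 : x - y + 1 ≤ Real.exp (x - y) := Real.add_one_le_exp _
    have h3 : Real.exp (-x) ≤ 1 := Real.exp_le_one_iff.2 (by linarith)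
    have h4 : Real.exp (x - y) ≤ 1 := Real.exp_le_one_iff.2 (by linarith)
    have h5 := Real.exp_pos (-x)
    rw [h1, abs_of_nonneg (by nlinarith), abs_of_nonpos (by linarith)]
    nlinarith

theorem survival_sub_le (hv : LipschitzWith K v) (hv0 : 0 < v 0) (hv1 : 0 < v 1) (ha : 0 ≤ a)
    (hq : Measurable q) (hq1 : ∀ x, q x ∈ Icc (0 : ℝ) 1) {s t : ℝ} (hs : 0 ≤ s) (ht : 0 ≤ t)
    (x : I) : |survival v a q t x - survival v a q s x| ≤ a * |t - s| := by
  have h0 : ∀ r, 0 ≤ r → 0 ≤ a * ∫ s in (0 : ℝ)..r, q (flow v (max s 0) x) := fun r hr =>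
    mul_nonneg ha (intervalIntegral.integral_nonneg hr fun s _ => (hq1 _).1)
  unfold survival
  rw [neg_mul, neg_mul]
  refine (abs_exp_neg_sub_le (h0 t ht) (h0 s hs)).trans ?_
  rw [← mul_sub, abs_mul, abs_of_nonneg ha, intervalIntegral.integral_interval_sub_left
    (intervalIntegrable_rate hv hv0 hv1 hq hq1 x _ _)
    (intervalIntegrable_rate hv hv0 hv1 hq hq1 x _ _)]
  refine mul_le_mul_of_nonneg_left ?_ ha
  have := intervalIntegral.norm_integral_le_of_norm_le_const (a := s) (b := t) (C := 1)
    (f := fun r => q (flow v (max r 0) x)) fun r _ => by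
      rw [Real.norm_of_nonneg (hq1 _).1]; exact (hq1 _).2
  simpa using this

/-- This is `w' = -a q(Φ) w` in integrated form; continuity of `q` makes the exponent differentiable
at every time. -/
theorem survival_eq_of_continuous (hv : LipschitzWith K v) (hv0 : 0 < v 0) (hv1 : 0 < v 1)
    (hq : Continuous q) (t : ℝ) (x : I) :
    survival v a q t x =
      1 - a * ∫ s in (0 : ℝ)..t, q (flow v (max s 0) x) * survival v a q s x := by
  have hc : Continuous fun s => q (flow v (max s 0) x) :=
    hq.comp ((continuous_flow hv hv0 hv1).comp (by fun_prop : Continuous fun s : ℝ => (s, x)))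
  have hd : ∀ s, HasDerivAt (fun s => survival v a q s x)
      (survival v a q s x * (-a * q (flow v (max s 0) x))) s := fun s =>
    ((hc.integral_hasStrictDerivAt 0 s).hasDerivAt.const_mul (-a)).exp
  have hcs : Continuous fun s => survival v a q s x :=
    continuous_iff_continuousAt.2 fun s => (hd s).continuousAt
  have := intervalIntegral.integral_eq_sub_of_hasDerivAt (a := 0) (b := t) (fun s _ => hd s)
    ((hcs.mul (hc.const_mul (-a))).intervalIntegrable _ _)
  have h0 : survival v a q 0 x = 1 := by simp [survival]
  rw [h0] at this
  rw [sub_eq_iff_eq_add'.1 this.symm, ← intervalIntegral.integral_const_mul, sub_eq_add_neg,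
    ← intervalIntegral.integral_neg]
  congr 2
  ext s
  ring

theorem tendsto_survival (hv : LipschitzWith K v) (hv0 : 0 < v 0) (hv1 : 0 < v 1) (t : ℝ) (x : I) :
    Tendsto (fun n => survival v a (regularizer n) t x) atTop
      (𝓝 (survival v a boundaryIndicator t x)) := by
  refine (Real.continuous_exp.tendsto _).comp (Tendsto.const_mul _ ?_)
  refine intervalIntegral.tendsto_integral_filter_of_dominated_convergence (fun _ => 1)
    (Eventually.of_forall fun n => ((measurable_rate hv hv0 hv1
      (lipschitzWith_regularizer n).continuous.measurable).comp
        measurable_prodMk_right).aestronglyMeasurable)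
    (Eventually.of_forall fun n => Eventually.of_forall fun s _ => ?_)
    intervalIntegrable_const (Eventually.of_forall fun s _ => tendsto_regularizer _)
  rw [Real.norm_of_nonneg (regularizer_mem n _).1]
  exact (regularizer_mem n _).2

/-- The boundary rate may jump on arrival, so the identity is obtained from the regularized ones by
dominated convergence. -/
theorem survival_boundary_eq (hv : LipschitzWith K v) (hv0 : 0 < v 0) (hv1 : 0 < v 1) (ha : 0 ≤ a)
    {t : ℝ} (ht : 0 ≤ t) (x : I) :
    survival v a boundaryIndicator t x =
      1 - a * ∫ s in (0 : ℝ)..t,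
        boundaryIndicator (flow v (max s 0) x) * survival v a boundaryIndicator s x := by
  have h1 : ∀ n, survival v a (regularizer n) t x =
      1 - a * ∫ s in (0 : ℝ)..t,
        regularizer n (flow v (max s 0) x) * survival v a (regularizer n) s x := fun n =>
    survival_eq_of_continuous hv hv0 hv1 (lipschitzWith_regularizer n).continuous t x
  refine tendsto_nhds_unique (tendsto_survival hv hv0 hv1 t x) ?_
  simp_rw [h1]
  refine Tendsto.const_sub _ (Tendsto.const_mul _ ?_)
  refine intervalIntegral.tendsto_integral_filter_of_dominated_convergence (fun _ => 1)
    (Eventually.of_forall fun n => ?_)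
    (Eventually.of_forall fun n => Eventually.of_forall fun s hs => ?_)
    intervalIntegrable_const (Eventually.of_forall fun s _ =>
      (tendsto_regularizer _).mul (tendsto_survival hv hv0 hv1 s x))
  · have hm := (lipschitzWith_regularizer n).continuous.measurable
    rw [uIoc_of_le ht]
    refine AEStronglyMeasurable.congr (f := fun s => regularizer n (flow v (max s 0) x) *
      survival v a (regularizer n) (max s 0) x)
      (((measurable_rate hv hv0 hv1 hm).comp measurable_prodMk_right).mul
        ((measurable_survival hv hv0 hv1 hm).comp measurable_prodMk_right)).aestronglyMeasurable ?_
    filter_upwards [ae_restrict_mem measurableSet_Ioc] with s hs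
    rw [max_eq_left hs.1.le]
  · rw [uIoc_of_le ht] at hs
    rw [Real.norm_of_nonneg (mul_nonneg (regularizer_mem n _).1 (survival_pos _ _).le)]
    exact mul_le_one₀ (regularizer_mem n _).2 (survival_pos _ _).le
      (survival_le_one ha (regularizer_mem n) hs.1.le x)

end Survival

end StickyBoundary

namespace StickyBoundary

/-! ### Bounded Lipschitz functions on the interval -/

theorem BL.abs_apply_le (φ : BL I) (x : I) : |φ x| ≤ ‖φ‖ :=
  (φ.toBCF.norm_coe_le_norm x).trans (le_add_of_nonneg_right φ.lipConst_nonneg)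

theorem BL.abs_sub_le (φ : BL I) (x y : I) : |φ x - φ y| ≤ ‖φ‖ * dist x y := by
  rcases eq_or_ne x y with rfl | hxy
  · simp
  · rw [← div_le_iff₀ (dist_pos.2 hxy)]
    exact (φ.quot_le (x, y)).trans (le_add_of_nonneg_left (norm_nonneg _))

theorem BL.measurable (φ : BL I) : Measurable (φ : I → ℝ) := φ.toBCF.continuous.measurable

/-- A Lipschitz function on `[0,1]` as an element of `BL`. -/
noncomputable def BL.ofLipschitz {f : I → ℝ} {L : ℝ≥0} (hf : LipschitzWith L f) : BL I :=
  ⟨BoundedContinuousFunction.mkOfCompact ⟨f, hf.continuous⟩, L, hf⟩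

theorem BL.norm_ofLipschitz_le {f : I → ℝ} {L : ℝ≥0} (hf : LipschitzWith L f) {C : ℝ}
    (hC : 0 ≤ C) (h : ∀ x, |f x| ≤ C) : ‖BL.ofLipschitz hf‖ ≤ C + L := by
  rw [BL.norm_def]
  refine add_le_add ((BoundedContinuousFunction.norm_le hC).2 h) (Real.iSup_le (fun p => ?_) L.2)
  exact div_le_of_le_mul₀ dist_nonneg L.2 (hf.dist_le_mul p.1 p.2)

theorem measureFunctional_apply (μ : Measure I) [IsFiniteMeasure μ] (φ : BL I) :
    measureFunctional μ φ = ∫ x, φ x ∂μ := rfl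

/-- Thickened indicators of a closed set are Lipschitz and converge to its indicator, and closed
sets form a generating π-system. -/
theorem measureFunctional_injective {μ ν : Measure I} [IsFiniteMeasure μ] [IsFiniteMeasure ν]
    (h : measureFunctional μ = measureFunctional ν) : μ = ν := by
  have hF : ∀ F : Set I, IsClosed F → μ F = ν F := by
    intro F hF
    have hδ : ∀ n : ℕ, (0 : ℝ) < 1 / (n + 1) := fun n => by positivity
    have h1 := tendsto_integral_thickenedIndicator_of_isClosed μ hF hδ
      tendsto_one_div_add_atTop_nhds_zero_nat
    have h2 := tendsto_integral_thickenedIndicator_of_isClosed ν hF hδ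
      tendsto_one_div_add_atTop_nhds_zero_nat
    have h3 : ∀ n : ℕ, ∫ x, (thickenedIndicator (hδ n) F x : ℝ) ∂μ =
        ∫ x, (thickenedIndicator (hδ n) F x : ℝ) ∂ν := fun n =>
      DFunLike.congr_fun h (BL.ofLipschitz (lipschitzWith_thickenedIndicator (hδ n) F))
    simp_rw [h3] at h1
    exact (measureReal_eq_measureReal_iff).1 (tendsto_nhds_unique h1 h2)
  exact ext_of_generate_finite _ (BorelSpace.measurable_eq.trans borel_eq_generateFrom_isClosed)
    isPiSystem_isClosed (fun F h => hF F h) (hF univ isClosed_univ)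

/-- The Jordan parts need not be identified: the positive part is `ρ` plus the negative part, and
the latter cancels. -/
theorem signedFunctional_toSignedMeasure (ρ : Measure I) [IsFiniteMeasure ρ] :
    signedFunctional ρ.toSignedMeasure = measureFunctional ρ := by
  set j := ρ.toSignedMeasure.toJordanDecomposition with hj
  have h1 : j.posPart.toSignedMeasure - j.negPart.toSignedMeasure = ρ.toSignedMeasure :=
    SignedMeasure.toSignedMeasure_toJordanDecomposition _
  have h2 : j.posPart = ρ + j.negPart := by
    rw [← Measure.toSignedMeasure_eq_toSignedMeasure_iff, Measure.toSignedMeasure_add, ← h1,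
      sub_add_cancel]
  ext φ
  change ∫ x, φ x ∂j.posPart - ∫ x, φ x ∂j.negPart = ∫ x, φ x ∂ρ
  rw [h2, integral_add_measure (φ.toBCF.integrable ρ) (φ.toBCF.integrable j.negPart),
    add_sub_cancel_right]

/-! ### Weighted push-forwards -/

/-- The measure `min (w, 1) dμ`. -/
noncomputable def weighted (w : I → ℝ) (μ : FiniteMeasure I) : FiniteMeasure I :=
  ⟨(μ : Measure I).withDensity fun x => ENNReal.ofReal (min (w x) 1),
    isFiniteMeasure_withDensity (by
      refine ne_top_of_le_ne_top (measure_ne_top (μ : Measure I) univ) ?_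
      calc ∫⁻ x, ENNReal.ofReal (min (w x) 1) ∂(μ : Measure I)
          ≤ ∫⁻ _, 1 ∂(μ : Measure I) := lintegral_mono fun x => by simp
        _ = (μ : Measure I) univ := by simp)⟩

theorem integral_withDensity_ofReal (μ : Measure I) {w : I → ℝ} (hw : Measurable w)
    (hw0 : ∀ x, 0 ≤ w x) (φ : I → ℝ) :
    ∫ x, φ x ∂μ.withDensity (fun x => ENNReal.ofReal (w x)) = ∫ x, w x * φ x ∂μ := by
  rw [integral_withDensity_eq_integral_toReal_smul hw.ennreal_ofReal
    (Eventually.of_forall fun _ => ENNReal.ofReal_lt_top)]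
  simp_rw [ENNReal.toReal_ofReal (hw0 _), smul_eq_mul]

theorem integral_weighted (μ : FiniteMeasure I) {w : I → ℝ} (hw : Measurable w)
    (hw1 : ∀ x, w x ∈ Icc (0 : ℝ) 1) (φ : I → ℝ) :
    ∫ x, φ x ∂(weighted w μ : Measure I) = ∫ x, w x * φ x ∂(μ : Measure I) := by
  -- The truncation at `1` only ensures finiteness for arbitrary `w`; it is inactive under `hw1`.
  have : (weighted w μ : Measure I) =
      (μ : Measure I).withDensity fun x => ENNReal.ofReal (w x) := by
    change (μ : Measure I).withDensity _ = _
    simp_rw [min_eq_left (hw1 _).2]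
  rw [this, integral_withDensity_ofReal _ hw fun x => (hw1 x).1]

theorem integral_regularize (n : ℕ) (μ : FiniteMeasure I) (φ : I → ℝ) :
    ∫ x, φ x ∂(regularize n μ : Measure I) = ∫ x, regularizer n x * φ x ∂(μ : Measure I) :=
  integral_withDensity_ofReal _ (lipschitzWith_regularizer n).continuous.measurable
    (fun x => (regularizer_mem n x).1) φ

theorem integrable_of_bound (μ : FiniteMeasure I) {f : I → ℝ} (hf : Measurable f) {C : ℝ}
    (hC : ∀ x, |f x| ≤ C) : Integrable f (μ : Measure I) :=
  Integrable.of_bound hf.aestronglyMeasurable C (Eventually.of_forall hC)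

/-- Comparison of two weighted push-forwards of the same measure in the dual norm. -/
theorem norm_measureFunctional_sub_le (μ₀ : FiniteMeasure I) {μ μ' : FiniteMeasure I}
    {w w' : I → ℝ} {Φ Φ' : I → I} (hw : Measurable w) (hw' : Measurable w') (hΦ : Measurable Φ)
    (hΦ' : Measurable Φ') (hw1 : ∀ x, w x ∈ Icc (0 : ℝ) 1) (hw1' : ∀ x, w' x ∈ Icc (0 : ℝ) 1)
    (hμ : ∀ φ : BL I, ∫ x, φ x ∂(μ : Measure I) = ∫ x, w x * φ (Φ x) ∂(μ₀ : Measure I))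
    (hμ' : ∀ φ : BL I, ∫ x, φ x ∂(μ' : Measure I) = ∫ x, w' x * φ (Φ' x) ∂(μ₀ : Measure I))
    {ε η : ℝ} (hε : ∀ x, |w x - w' x| ≤ ε) (hη : ∀ x, dist (Φ x) (Φ' x) ≤ η) :
    ‖measureFunctional (μ : Measure I) - measureFunctional (μ' : Measure I)‖
      ≤ (ε + η) * (μ₀ : Measure I).real univ := by
  have hε0 : 0 ≤ ε := (abs_nonneg _).trans (hε 0)
  have hη0 : 0 ≤ η := dist_nonneg.trans (hη 0)
  refine ContinuousLinearMap.opNorm_le_bound _ (by positivity) fun φ => ?_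
  have hint : ∀ (u : I → ℝ) (Θ : I → I), Measurable u → Measurable Θ →
      (∀ x, u x ∈ Icc (0 : ℝ) 1) → Integrable (fun x => u x * φ (Θ x)) (μ₀ : Measure I) := by
    intro u Θ hu hΘ hu1
    refine integrable_of_bound μ₀ (hu.mul (φ.measurable.comp hΘ)) (C := ‖φ‖) fun x => ?_
    rw [abs_mul, abs_of_nonneg (hu1 x).1]
    exact (mul_le_of_le_one_left (abs_nonneg _) (hu1 x).2).trans (φ.abs_apply_le _)
  change ‖∫ x, φ x ∂(μ : Measure I) - ∫ x, φ x ∂(μ' : Measure I)‖ ≤ _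
  rw [hμ, hμ', ← integral_sub (hint w Φ hw hΦ hw1) (hint w' Φ' hw' hΦ' hw1')]
  refine (norm_integral_le_of_norm_le_const (C := (ε + η) * ‖φ‖)
    (Eventually.of_forall fun x => ?_)).trans_eq (by ring)
  -- The error in the weight is paid by the supremum norm of `φ`, the error in the map by its
  -- Lipschitz constant.
  calc ‖w x * φ (Φ x) - w' x * φ (Φ' x)‖
      = |(w x - w' x) * φ (Φ x) + w' x * (φ (Φ x) - φ (Φ' x))| := by
        rw [Real.norm_eq_abs]; ring_nf
    _ ≤ |w x - w' x| * |φ (Φ x)| + |w' x| * |φ (Φ x) - φ (Φ' x)| := by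
        rw [← abs_mul, ← abs_mul]; exact abs_add_le _ _
    _ ≤ ε * ‖φ‖ + 1 * (‖φ‖ * η) := by
        have h1 : |w' x| ≤ 1 := by rw [abs_of_nonneg (hw1' x).1]; exact (hw1' x).2
        have h2 := (φ.abs_sub_le (Φ x) (Φ' x)).trans
          (mul_le_mul_of_nonneg_left (hη x) (norm_nonneg _))
        gcongr
        · exact hε x
        · exact φ.abs_apply_le _
    _ = (ε + η) * ‖φ‖ := by ring

/-! ### The explicit solutions -/

section Solution

variable {v : I → ℝ} {K : ℝ≥0} {a : ℝ} {q : I → ℝ}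

theorem measurable_flow (hv : LipschitzWith K v) (hv0 : 0 < v 0) (hv1 : 0 < v 1) {t : ℝ}
    (ht : 0 ≤ t) : Measurable (flow v t) := by
  have := (continuous_flow hv hv0 hv1).measurable.comp (measurable_prodMk_left (x := t))
  simpa only [Function.comp_def, max_eq_left ht] using this

theorem integral_transport (hv : LipschitzWith K v) (hv0 : 0 < v 0) (hv1 : 0 < v 1) {t : ℝ}
    (ht : 0 ≤ t) (μ : FiniteMeasure I) {φ : I → ℝ} (hφ : Measurable φ) :
    ∫ x, φ x ∂(transport v t μ : Measure I) = ∫ x, φ (flow v t x) ∂(μ : Measure I) := by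
  rw [transport, FiniteMeasure.toMeasure_map, integral_map (measurable_flow hv hv0 hv1 ht).aemeasurable
    hφ.aestronglyMeasurable]

/-- The mass transported along the flow and killed at rate `a q`. -/
noncomputable def killedTransport (v : I → ℝ) (a : ℝ) (q : I → ℝ) (μ₀ : FiniteMeasure I) (t : ℝ) :
    FiniteMeasure I :=
  transport v t (weighted (survival v a q t) μ₀)

theorem measurable_survival_at (hv : LipschitzWith K v) (hv0 : 0 < v 0) (hv1 : 0 < v 1)
    (hq : Measurable q) {t : ℝ} (ht : 0 ≤ t) : Measurable (survival v a q t) := by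
  have := (measurable_survival (a := a) hv hv0 hv1 hq).comp (measurable_prodMk_left (x := t))
  simpa only [Function.comp_def, max_eq_left ht] using this

theorem survival_mem (ha : 0 ≤ a) (hq1 : ∀ x, q x ∈ Icc (0 : ℝ) 1) {t : ℝ} (ht : 0 ≤ t)
    (x : I) : survival v a q t x ∈ Icc (0 : ℝ) 1 :=
  ⟨(survival_pos t x).le, survival_le_one ha hq1 ht x⟩

theorem integral_killedTransport (hv : LipschitzWith K v) (hv0 : 0 < v 0) (hv1 : 0 < v 1)
    (ha : 0 ≤ a) (hq : Measurable q) (hq1 : ∀ x, q x ∈ Icc (0 : ℝ) 1) (μ₀ : FiniteMeasure I)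
    {t : ℝ} (ht : 0 ≤ t) {φ : I → ℝ} (hφ : Measurable φ) :
    ∫ x, φ x ∂(killedTransport v a q μ₀ t : Measure I) =
      ∫ x, survival v a q t x * φ (flow v t x) ∂(μ₀ : Measure I) := by
  rw [killedTransport, integral_transport hv hv0 hv1 ht _ hφ,
    integral_weighted _ (measurable_survival_at hv hv0 hv1 hq ht) (survival_mem ha hq1 ht)]

/-- The curve is even Lipschitz: weights change at rate at most `a` and points move at speed at most
`M`, uniformly in the starting point. -/
theorem continuousOn_killedTransport (hv : LipschitzWith K v) (hv0 : 0 < v 0) (hv1 : 0 < v 1)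
    (ha : 0 ≤ a) (hq : Measurable q) (hq1 : ∀ x, q x ∈ Icc (0 : ℝ) 1) (μ₀ : FiniteMeasure I) :
    ContinuousOn (fun t => measureFunctional (killedTransport v a q μ₀ t : Measure I)) (Ici 0) := by
  obtain ⟨M, hM⟩ := exists_lipschitzWith_flow_time hv hv0 hv1
  have hL : (0 : ℝ) ≤ (a + M) * (μ₀ : Measure I).real univ := by positivity
  refine (LipschitzOnWith.of_dist_le_mul (K := .mk _ hL) fun t ht s hs => ?_).continuousOn
  rw [mem_Ici] at ht hs
  rw [dist_eq_norm]
  refine (norm_measureFunctional_sub_le μ₀ (measurable_survival_at hv hv0 hv1 hq ht)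
    (measurable_survival_at hv hv0 hv1 hq hs) (measurable_flow hv hv0 hv1 ht)
    (measurable_flow hv hv0 hv1 hs) (survival_mem ha hq1 ht) (survival_mem ha hq1 hs)
    (fun φ => integral_killedTransport hv hv0 hv1 ha hq hq1 μ₀ ht φ.measurable)
    (fun φ => integral_killedTransport hv hv0 hv1 ha hq hq1 μ₀ hs φ.measurable)
    (ε := a * |t - s|) (η := M * |t - s|)
    (survival_sub_le hv hv0 hv1 ha hq hq1 hs ht) fun x => ?_).trans_eq ?_
  · have := (hM x).dist_le_mul t s
    rwa [max_eq_left ht, max_eq_left hs] at this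
  · rw [Real.dist_eq, NNReal.coe_mk]
    ring

theorem measurable_killing (hv : LipschitzWith K v) (hv0 : 0 < v 0) (hv1 : 0 < v 1)
    (hq : Measurable q) : Measurable fun p : ℝ × I =>
      survival v a q (max p.1 0) p.2 * q (flow v (max p.1 0) p.2) :=
  (measurable_survival hv hv0 hv1 hq).mul (measurable_rate hv hv0 hv1 hq)

/-- Fubini: the mass killed up to time `t`, tested against `ψ`. -/
theorem integral_killing (hv : LipschitzWith K v) (hv0 : 0 < v 0) (hv1 : 0 < v 1)
    (ha : 0 ≤ a) (hq : Measurable q) (hq1 : ∀ x, q x ∈ Icc (0 : ℝ) 1) (μ₀ : FiniteMeasure I)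
    {t : ℝ} (ht : 0 ≤ t) (hid : ∀ x, survival v a q t x =
      1 - a * ∫ s in (0 : ℝ)..t, q (flow v (max s 0) x) * survival v a q s x)
    {ψ : I → ℝ} (hψ : Measurable ψ) {C : ℝ} (hC : ∀ x, |ψ x| ≤ C) :
    a * ∫ s in (0 : ℝ)..t, ∫ x, survival v a q s x * q (flow v s x) * ψ x ∂(μ₀ : Measure I) =
      ∫ x, (1 - survival v a q t x) * ψ x ∂(μ₀ : Measure I) := by
  -- Clamped times make the integrand jointly measurable, as Fubini requires.
  have h1 : ∫ s in (0 : ℝ)..t, ∫ x, survival v a q s x * q (flow v s x) * ψ x ∂(μ₀ : Measure I) =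
      ∫ s in (0 : ℝ)..t, ∫ x, survival v a q (max s 0) x * q (flow v (max s 0) x) * ψ x
        ∂(μ₀ : Measure I) := by
    refine intervalIntegral.integral_congr fun s hs => ?_
    rw [uIcc_of_le ht] at hs
    simp only [max_eq_left hs.1]
  rw [h1, intervalIntegral_integral_swap, ← integral_const_mul]
  · congr 1
    ext x
    rw [intervalIntegral.integral_mul_const, hid x, sub_sub_cancel, ← mul_assoc]
    congr 2
    refine intervalIntegral.integral_congr fun s hs => ?_
    rw [uIcc_of_le ht] at hs
    simp only [max_eq_left hs.1]
    ring
  · rw [uIoc_of_le ht]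
    refine Integrable.of_bound (C := C) (((measurable_killing hv hv0 hv1 hq).mul
      (hψ.comp measurable_snd)).aestronglyMeasurable) (Eventually.of_forall fun p => ?_)
    have h2 := survival_mem (v := v) ha hq1 (le_max_right p.1 0) p.2
    have h3 := hq1 (flow v (max p.1 0) p.2)
    change |survival v a q (max p.1 0) p.2 * q (flow v (max p.1 0) p.2) * ψ p.2| ≤ C
    rw [abs_mul, abs_of_nonneg (mul_nonneg h2.1 h3.1)]
    exact (mul_le_of_le_one_left (abs_nonneg _) (mul_le_one₀ h2.2 h3.1 h3.2)).trans (hC _)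

/-- The mass killed at time `s`, transported until time `t`. -/
theorem integral_transport_regularize (hv : LipschitzWith K v) (hv0 : 0 < v 0) (hv1 : 0 < v 1)
    (ha : 0 ≤ a) (n : ℕ) (μ₀ : FiniteMeasure I) {s t : ℝ} (hs : 0 ≤ s) (hst : s ≤ t)
    {φ : I → ℝ} (hφ : Measurable φ) :
    ∫ x, φ x ∂(transport v (t - s)
        (regularize n (killedTransport v a (regularizer n) μ₀ s)) : Measure I) =
      ∫ x, survival v a (regularizer n) s x * regularizer n (flow v s x) * φ (flow v t x)
        ∂(μ₀ : Measure I) := by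
  have hts := sub_nonneg.2 hst
  have hm := (lipschitzWith_regularizer n).continuous.measurable
  rw [integral_transport hv hv0 hv1 hts _ hφ, integral_regularize,
    integral_killedTransport hv hv0 hv1 ha hm (regularizer_mem n) _ hs
      (φ := fun y => regularizer n y * φ (flow v (t - s) y)) (hm.mul (hφ.comp (measurable_flow hv hv0 hv1 hts)))]
  congr 1
  ext x
  rw [flow_add hv hv0 hv1 hs hts, sub_add_cancel, mul_assoc]

/-- By the semigroup law the total map is `Φ_t` for every `s`, so only the weight varies (`η = 0`):
survival contributes `a` and the regularizer along the flow `n * M`. -/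
theorem continuousOn_transport_regularize (hv : LipschitzWith K v) (hv0 : 0 < v 0) (hv1 : 0 < v 1)
    (ha : 0 ≤ a) (n : ℕ) (μ₀ : FiniteMeasure I) (t : ℝ) :
    ContinuousOn (fun s => measureFunctional (transport v (t - s)
        (regularize n (killedTransport v a (regularizer n) μ₀ s)) : Measure I)) (Icc 0 t) := by
  obtain ⟨M, hM⟩ := exists_lipschitzWith_flow_time hv hv0 hv1
  have hm := (lipschitzWith_regularizer n).continuous.measurable
  have hL : (0 : ℝ) ≤ (a + n * M + 0) * (μ₀ : Measure I).real univ := by positivity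
  refine (LipschitzOnWith.of_dist_le_mul (K := .mk _ hL) fun r hr s hs => ?_).continuousOn
  have ht := hr.1.trans hr.2
  have hw : ∀ r, 0 ≤ r → Measurable fun x =>
      survival v a (regularizer n) r x * regularizer n (flow v r x) := fun r hr =>
    (measurable_survival_at hv hv0 hv1 hm hr).mul (hm.comp (measurable_flow hv hv0 hv1 hr))
  have hw1 : ∀ r, 0 ≤ r → ∀ x,
      survival v a (regularizer n) r x * regularizer n (flow v r x) ∈ Icc (0 : ℝ) 1 := by
    intro r hr x
    have h1 := survival_mem (v := v) ha (regularizer_mem n) hr x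
    have h2 := regularizer_mem n (flow v r x)
    exact ⟨mul_nonneg h1.1 h2.1, mul_le_one₀ h1.2 h2.1 h2.2⟩
  rw [dist_eq_norm]
  refine (norm_measureFunctional_sub_le μ₀ (hw r hr.1) (hw s hs.1) (measurable_flow hv hv0 hv1 ht)
    (measurable_flow hv hv0 hv1 ht) (hw1 r hr.1) (hw1 s hs.1)
    (fun φ => integral_transport_regularize hv hv0 hv1 ha n μ₀ hr.1 hr.2 φ.measurable)
    (fun φ => integral_transport_regularize hv hv0 hv1 ha n μ₀ hs.1 hs.2 φ.measurable)
    (ε := (a + n * M) * |r - s|) (η := 0) (fun x => ?_) fun x => (dist_self _).le).trans_eq ?_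
  · have h1 := survival_sub_le hv hv0 hv1 ha hm (regularizer_mem n) hs.1 hr.1 x
    have h2 : |regularizer n (flow v r x) - regularizer n (flow v s x)| ≤ n * (M * |r - s|) := by
      have h3 := (lipschitzWith_regularizer n).dist_le_mul (flow v r x) (flow v s x)
      have h4 := (hM x).dist_le_mul r s
      rw [max_eq_left hr.1, max_eq_left hs.1] at h4
      exact h3.trans (mul_le_mul_of_nonneg_left h4 (by positivity))
    have h5 := survival_mem (v := v) ha (regularizer_mem n) hs.1 x
    have h6 := regularizer_mem n (flow v r x)
    set A := survival v a (regularizer n) r x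
    set A' := survival v a (regularizer n) s x
    set B := regularizer n (flow v r x)
    set B' := regularizer n (flow v s x)
    calc |A * B - A' * B'| = |(A - A') * B + A' * (B - B')| := by ring_nf
      _ ≤ |A - A'| * |B| + |A'| * |B - B'| := by
          rw [← abs_mul, ← abs_mul]; exact abs_add_le _ _
      _ ≤ a * |r - s| * 1 + 1 * (n * (M * |r - s|)) := by
          rw [abs_of_nonneg h6.1, abs_of_nonneg h5.1]
          have := h5.1
          have := h6.1
          exact add_le_add (mul_le_mul h1 h6.2 h6.1 (by positivity))
            (mul_le_mul h5.2 h2 (abs_nonneg _) zero_le_one)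
      _ = (a + n * M) * |r - s| := by ring
  · rw [Real.dist_eq, NNReal.coe_mk]
    ring

theorem isRegularizedSolution_killedTransport (hv : LipschitzWith K v) (hv0 : 0 < v 0)
    (hv1 : 0 < v 1) (ha : 0 ≤ a) (n : ℕ) (μ₀ : FiniteMeasure I) :
    IsRegularizedSolution v a n μ₀ (killedTransport v a (regularizer n) μ₀) := by
  have hc := (lipschitzWith_regularizer n).continuous
  have hint : ∀ t, 0 ≤ t → IntervalIntegrable (fun s => measureFunctional (transport v (t - s)
      (regularize n (killedTransport v a (regularizer n) μ₀ s)) : Measure I)) volume 0 t := by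
    intro t ht
    refine ContinuousOn.intervalIntegrable ?_
    rw [uIcc_of_le ht]
    exact continuousOn_transport_regularize hv hv0 hv1 ha n μ₀ t
  refine ⟨continuousOn_killedTransport hv hv0 hv1 ha hc.measurable (regularizer_mem n) μ₀, hint,
    fun t ht => ?_⟩
  ext φ
  rw [intervalIntegral.integral_smul, add_apply,
    smul_apply, ContinuousLinearMap.intervalIntegral_apply (hint t ht),
    smul_eq_mul]
  simp only [measureFunctional_apply]
  have hφt := φ.measurable.comp (measurable_flow hv hv0 hv1 ht)
  have h1 : ∫ s in (0 : ℝ)..t, ∫ x, φ x ∂(transport v (t - s)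
        (regularize n (killedTransport v a (regularizer n) μ₀ s)) : Measure I) =
      ∫ s in (0 : ℝ)..t, ∫ x, survival v a (regularizer n) s x * regularizer n (flow v s x) *
        φ (flow v t x) ∂(μ₀ : Measure I) := by
    refine intervalIntegral.integral_congr fun s hs => ?_
    rw [uIcc_of_le ht] at hs
    exact integral_transport_regularize hv hv0 hv1 ha n μ₀ hs.1 hs.2 φ.measurable
  rw [h1, neg_mul, integral_killing hv hv0 hv1 ha hc.measurable (regularizer_mem n) μ₀ ht
    (survival_eq_of_continuous hv hv0 hv1 hc t) (ψ := fun x => φ (flow v t x)) hφt (C := ‖φ‖) (fun x => φ.abs_apply_le _),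
    integral_transport hv hv0 hv1 ht _ φ.measurable, integral_killedTransport hv hv0 hv1 ha
      hc.measurable (regularizer_mem n) μ₀ ht φ.measurable, ← sub_eq_add_neg, ← integral_sub]
  · congr 1
    ext x
    ring
  · exact integrable_of_bound μ₀ hφt fun x => φ.abs_apply_le _
  · refine integrable_of_bound μ₀ (C := ‖φ‖) (((measurable_survival_at hv hv0 hv1 hc.measurable
      ht).const_sub 1).mul hφt) fun x => ?_
    have h2 := survival_mem (v := v) ha (regularizer_mem n) ht x
    rw [abs_mul, abs_of_nonneg (sub_nonneg.2 h2.2)]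
    exact (mul_le_of_le_one_left (abs_nonneg _) (sub_le_self _ h2.1)).trans (φ.abs_apply_le _)

/-- Up to its arrival at the boundary, a particle survives in the limit system. -/
theorem survival_boundary_eq_one (hv : LipschitzWith K v) (hv0 : 0 < v 0) (hv1 : 0 < v 1) {t : ℝ}
    (ht : 0 ≤ t) {x : I} (hx : flow v t x ≠ 1) : survival v a boundaryIndicator t x = 1 := by
  have h1 : ∫ s in (0 : ℝ)..t, boundaryIndicator (flow v (max s 0) x) = ∫ s in (0 : ℝ)..t, 0 := by
    refine intervalIntegral.integral_congr fun s hs => ?_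
    rw [uIcc_of_le ht] at hs
    exact boundaryIndicator_of_ne fun h =>
      hx (flow_eq_one_of_le hv hv0 hv1 (le_max_right s 0) (max_le hs.2 ht) h)
  simp [survival, h1]

theorem measureReal_eq_integral (μ : Measure I) {A : Set I} (hA : MeasurableSet A) :
    μ.real A = ∫ x, A.indicator (1 : I → ℝ) x ∂μ := (integral_indicator_one hA).symm

theorem isLimitSolution_killedTransport (hv : LipschitzWith K v) (hv0 : 0 < v 0)
    (hv1 : 0 < v 1) (ha : 0 ≤ a) (μ₀ : FiniteMeasure I) :
    IsLimitSolution v a μ₀ fun t =>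
      (killedTransport v a boundaryIndicator μ₀ t : Measure I).toSignedMeasure := by
  have hq := measurable_boundaryIndicator
  have hmass : ∀ s, 0 ≤ s →
      (killedTransport v a boundaryIndicator μ₀ s : Measure I).toSignedMeasure {1} =
      ∫ x, survival v a boundaryIndicator s x * boundaryIndicator (flow v s x)
        ∂(μ₀ : Measure I) := fun s hs => by
    rw [Measure.toSignedMeasure_apply_measurable (measurableSet_singleton 1),
      measureReal_eq_integral _ (measurableSet_singleton 1)]
    exact integral_killedTransport hv hv0 hv1 ha hq boundaryIndicator_mem μ₀ hs hq
  refine ⟨?_, fun t ht => ?_, fun t ht => ?_⟩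
  · simp_rw [signedFunctional_toSignedMeasure]
    exact continuousOn_killedTransport hv hv0 hv1 ha hq boundaryIndicator_mem μ₀
  · have hm : Measurable fun s => ∫ x, survival v a boundaryIndicator (max s 0) x *
        boundaryIndicator (flow v (max s 0) x) ∂(μ₀ : Measure I) :=
      ((measurable_killing hv hv0 hv1 hq).stronglyMeasurable.integral_prod_right
        (ν := (μ₀ : Measure I))).measurable
    have hb : ∀ s, ‖∫ x, survival v a boundaryIndicator (max s 0) x *
        boundaryIndicator (flow v (max s 0) x) ∂(μ₀ : Measure I)‖ ≤
        1 * (μ₀ : Measure I).real univ := by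
      intro s
      refine norm_integral_le_of_norm_le_const (Eventually.of_forall fun x => ?_)
      have h2 := survival_mem (v := v) ha boundaryIndicator_mem (le_max_right s 0) x
      have h3 := boundaryIndicator_mem (flow v (max s 0) x)
      rw [Real.norm_of_nonneg (mul_nonneg h2.1 h3.1)]
      exact mul_le_one₀ h2.2 h3.1 h3.2
    refine IntervalIntegrable.congr (fun s hs => ?_)
      ((intervalIntegrable_const (c := 1 * (μ₀ : Measure I).real univ)).mono_fun
        hm.aestronglyMeasurable (Eventually.of_forall fun s => (hb s).trans (le_abs_self _)))
    rw [uIoc_of_le ht] at hs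
    rw [hmass s hs.1.le, max_eq_left hs.1.le]
  · have h1 : ∫ s in (0 : ℝ)..t,
        (killedTransport v a boundaryIndicator μ₀ s : Measure I).toSignedMeasure {1} =
        ∫ s in (0 : ℝ)..t, ∫ x, survival v a boundaryIndicator s x *
          boundaryIndicator (flow v s x) * 1 ∂(μ₀ : Measure I) := by
      refine intervalIntegral.integral_congr fun s hs => ?_
      rw [uIcc_of_le ht] at hs
      simp only [hmass s hs.1, mul_one]
    rw [h1, integral_killing hv hv0 hv1 ha hq boundaryIndicator_mem μ₀ ht
      (survival_boundary_eq hv hv0 hv1 ha ht) (ψ := fun _ => 1) measurable_const (C := 1) (by simp)]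
    ext A hA
    have hA' : Measurable (A.indicator (1 : I → ℝ)) := measurable_one.indicator hA
    have hA1 : ∀ x, A.indicator (1 : I → ℝ) x ∈ Icc (0 : ℝ) 1 := fun x =>
      ⟨indicator_nonneg (fun _ _ => zero_le_one) x, indicator_le_self' (by simp) x⟩
    have hst := measurable_survival_at (a := a) hv hv0 hv1 hq ht
    have hsm := survival_mem (v := v) ha boundaryIndicator_mem ht
    rw [sub_apply, smul_apply,
      Measure.toSignedMeasure_apply_measurable hA, Measure.toSignedMeasure_apply_measurable hA,
      Measure.toSignedMeasure_apply_measurable hA, measureReal_eq_integral _ hA,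
      measureReal_eq_integral _ hA, measureReal_eq_integral _ hA, integral_dirac,
      integral_killedTransport hv hv0 hv1 ha hq boundaryIndicator_mem μ₀ ht hA',
      integral_transport hv hv0 hv1 ht _ hA', smul_eq_mul, ← integral_mul_const, ← integral_sub]
    · congr 1
      ext x
      -- Mass has been lost only by particles now at `1`, so evaluating the test function at `1` or
      -- at `Φ_t x` is the same.
      by_cases hx : flow v t x = 1
      · rw [hx]; ring
      · rw [survival_boundary_eq_one hv hv0 hv1 ht hx]; ring
    · refine integrable_of_bound μ₀ (hA'.comp (measurable_flow hv hv0 hv1 ht)) (C := 1) fun x => ?_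
      rw [abs_of_nonneg (hA1 _).1]
      exact (hA1 _).2
    · refine integrable_of_bound μ₀ (((hst.const_sub 1).mul_const 1).mul_const _) (C := 1)
        fun x => ?_
      rw [mul_one, abs_of_nonneg (mul_nonneg (sub_nonneg.2 (hsm x).2) (hA1 1).1)]
      exact mul_le_one₀ (sub_le_self _ (hsm x).1) (hA1 1).1 (hA1 1).2

/-- The rate of convergence, uniform in time. -/
theorem exists_norm_killedTransport_sub_le (hv : LipschitzWith K v) (hv0 : 0 < v 0)
    (hv1 : 0 < v 1) (ha : 0 ≤ a) (μ₀ : FiniteMeasure I) :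
    ∃ C : ℝ, ∀ n : ℕ, 1 ≤ n → ∀ t, 0 ≤ t →
      ‖measureFunctional (killedTransport v a (regularizer n) μ₀ t : Measure I) -
        measureFunctional (killedTransport v a boundaryIndicator μ₀ t : Measure I)‖ ≤ C / n := by
  obtain ⟨D, N, hD, hN, hDN⟩ := exists_integral_regularizer_sub_le hv hv0 hv1
  -- The term `a * D` serves `n ≥ N`. The term `N` covers `n < N`, where the weights differ by at
  -- most `1 ≤ N / n`. The `0` is the error in the map.
  refine ⟨(a * D + N + 0) * (μ₀ : Measure I).real univ, fun n hn t ht => ?_⟩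
  have hn' : (0 : ℝ) < n := by positivity
  have hm := (lipschitzWith_regularizer n).continuous.measurable
  have hq := measurable_boundaryIndicator
  refine (norm_measureFunctional_sub_le μ₀ (measurable_survival_at hv hv0 hv1 hm ht)
    (measurable_survival_at hv hv0 hv1 hq ht) (measurable_flow hv hv0 hv1 ht)
    (measurable_flow hv hv0 hv1 ht) (survival_mem ha (regularizer_mem n) ht)
    (survival_mem ha boundaryIndicator_mem ht)
    (fun φ => integral_killedTransport hv hv0 hv1 ha hm (regularizer_mem n) μ₀ ht φ.measurable)
    (fun φ => integral_killedTransport hv hv0 hv1 ha hq boundaryIndicator_mem μ₀ ht φ.measurable)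
    (ε := (a * D + N) / n) (η := 0) (fun x => ?_) fun x => (dist_self _).le).trans_eq (by ring)
  rw [le_div_iff₀ hn']
  rcases le_or_gt N n with h | h
  · have h1 := hDN n h t ht x
    have h2 : |survival v a (regularizer n) t x - survival v a boundaryIndicator t x| ≤
        a * (D / n) := by
      have h0 : ∀ q : I → ℝ, (∀ x, q x ∈ Icc (0 : ℝ) 1) →
          0 ≤ a * ∫ s in (0 : ℝ)..t, q (flow v (max s 0) x) := fun q hq =>
        mul_nonneg ha (intervalIntegral.integral_nonneg ht fun s _ => (hq _).1)
      unfold survival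
      rw [neg_mul, neg_mul]
      refine (abs_exp_neg_sub_le (h0 _ (regularizer_mem n)) (h0 _ boundaryIndicator_mem)).trans ?_
      rw [← mul_sub, abs_mul, abs_of_nonneg ha, ← intervalIntegral.integral_sub
        (intervalIntegrable_rate hv hv0 hv1 hm (regularizer_mem n) x _ _)
        (intervalIntegrable_rate hv hv0 hv1 hq boundaryIndicator_mem x _ _)]
      refine mul_le_mul_of_nonneg_left (le_trans (le_of_eq ?_) h1) ha
      congr 1
      refine intervalIntegral.integral_congr fun s hs => ?_
      rw [uIcc_of_le ht] at hs
      simp only [max_eq_left hs.1]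
    calc _ ≤ a * (D / n) * n := mul_le_mul_of_nonneg_right h2 hn'.le
      _ = a * D := by field_simp
      _ ≤ a * D + N := le_add_of_nonneg_right N.cast_nonneg
  · have h1 := survival_mem (v := v) ha (regularizer_mem n) ht x
    have h2 := survival_mem (v := v) ha boundaryIndicator_mem ht x
    have h3 : |survival v a (regularizer n) t x - survival v a boundaryIndicator t x| ≤ 1 :=
      abs_sub_le_iff.2 ⟨by linarith [h1.2, h2.1], by linarith [h1.1, h2.2]⟩
    have h4 : (n : ℝ) ≤ N := by exact_mod_cast h.le
    have h5 : 0 ≤ a * D := mul_nonneg ha hD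
    nlinarith

end Solution

end StickyBoundary

namespace StickyBoundary

/-! ### Uniqueness -/

/-- Gronwall's lemma in integral form, with zero initial value. -/
theorem eq_zero_of_le_integral {u : ℝ → ℝ} {T C : ℝ} (hT : 0 ≤ T)
    (hu : ContinuousOn u (Icc 0 T)) (hu0 : ∀ t ∈ Icc 0 T, 0 ≤ u t)
    (h : ∀ t ∈ Icc 0 T, u t ≤ C * ∫ s in (0 : ℝ)..t, u s) : ∀ t ∈ Icc 0 T, u t = 0 := by
  -- A continuous extension makes the primitive differentiable up to the endpoints; the differential
  -- Gronwall lemma is applied to the primitive.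
  set g : ℝ → ℝ := IccExtend hT ((Icc 0 T).domRestrict u) with hg
  have hgc : Continuous g := (continuousOn_iff_continuous_domRestrict.1 hu).Icc_extend'
  have hgu : ∀ t ∈ Icc 0 T, g t = u t := fun t ht => IccExtend_of_mem _ _ ht
  have hgi : ∀ t ∈ Icc 0 T, ∫ s in (0 : ℝ)..t, g s = ∫ s in (0 : ℝ)..t, u s := by
    intro t ht
    refine intervalIntegral.integral_congr fun s hs => ?_
    rw [uIcc_of_le ht.1] at hs
    exact hgu s ⟨hs.1, hs.2.trans ht.2⟩
  have hd : ∀ t, HasDerivAt (fun t => ∫ s in (0 : ℝ)..t, g s) (g t) t := fun t =>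
    (hgc.integral_hasStrictDerivAt 0 t).hasDerivAt
  have hzero := eq_zero_of_abs_deriv_le_mul_abs_self_of_eq_zero_right (a := 0) (b := T) (K := C)
    (fun t _ => (hd t).continuousAt.continuousWithinAt) (fun t _ => (hd t).hasDerivWithinAt)
    (by simp) (fun t ht => by
      have ht' := Ico_subset_Icc_self ht
      have hpos : 0 ≤ ∫ s in (0 : ℝ)..t, u s :=
        intervalIntegral.integral_nonneg ht.1 fun s hs => hu0 s ⟨hs.1, hs.2.trans ht'.2⟩
      rw [hgi t ht', hgu t ht', Real.norm_of_nonneg (hu0 t ht'), Real.norm_of_nonneg hpos]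
      exact h t ht')
  intro t ht
  have h1 := hzero t ht
  rw [hgi t ht] at h1
  have h2 := h t ht
  rw [h1, mul_zero] at h2
  exact le_antisymm h2 (hu0 t ht)

variable {v : I → ℝ} {K : ℝ≥0} {a : ℝ}

/-- By duality the operators act on the test function, giving `f_n · (φ ∘ Φ_t)`. Its supremum
contributes `1`, and its Lipschitz constant `n` from `f_n` and the exponential from the flow. Growth
in `n` is harmless for uniqueness at fixed `n`. -/
theorem norm_transport_regularize_sub_le (hv : LipschitzWith K v) (hv0 : 0 < v 0) (hv1 : 0 < v 1)
    (n : ℕ) (μ μ' : FiniteMeasure I) {t T : ℝ} (ht : 0 ≤ t) (htT : t ≤ T) :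
    ‖measureFunctional (transport v t (regularize n μ) : Measure I) -
        measureFunctional (transport v t (regularize n μ') : Measure I)‖ ≤
      (1 + n + Real.exp (K * T)) *
        ‖measureFunctional (μ : Measure I) - measureFunctional (μ' : Measure I)‖ := by
  refine ContinuousLinearMap.opNorm_le_bound _ (by positivity) fun φ => ?_
  have hE : Real.exp (K * t) ≤ Real.exp (K * T) := by gcongr
  have hL : (0 : ℝ) ≤ (n + Real.exp (K * T)) * ‖φ‖ := by positivity
  have hlip : LipschitzWith (.mk _ hL) fun x => regularizer n x * φ (flow v t x) := by
    refine LipschitzWith.of_dist_le_mul fun x y => ?_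
    have h1 := (lipschitzWith_regularizer n).dist_le_mul x y
    have h2 := (φ.abs_sub_le (flow v t x) (flow v t y)).trans (mul_le_mul_of_nonneg_left
      ((flow_dist_le hv hv0 hv1 ht x y).trans (mul_le_mul_of_nonneg_right hE dist_nonneg))
      (norm_nonneg φ))
    have h3 := φ.abs_apply_le (flow v t x)
    have h4 := regularizer_mem n y
    rw [Real.dist_eq] at h1 ⊢
    rw [NNReal.coe_mk]
    calc |regularizer n x * φ (flow v t x) - regularizer n y * φ (flow v t y)|
        = |(regularizer n x - regularizer n y) * φ (flow v t x) +
            regularizer n y * (φ (flow v t x) - φ (flow v t y))| := by ring_nf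
      _ ≤ |regularizer n x - regularizer n y| * |φ (flow v t x)| +
            |regularizer n y| * |φ (flow v t x) - φ (flow v t y)| := by
          rw [← abs_mul, ← abs_mul]; exact abs_add_le _ _
      _ ≤ n * dist x y * ‖φ‖ + 1 * (‖φ‖ * (Real.exp (K * T) * dist x y)) := by
          rw [abs_of_nonneg h4.1]
          exact add_le_add (mul_le_mul h1 h3 (abs_nonneg _) (by positivity))
            (mul_le_mul h4.2 h2 (abs_nonneg _) zero_le_one)
      _ = (n + Real.exp (K * T)) * ‖φ‖ * dist x y := by ring
  have hval : ∀ ρ : FiniteMeasure I,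
      measureFunctional (transport v t (regularize n ρ) : Measure I) φ =
        measureFunctional (ρ : Measure I) (BL.ofLipschitz hlip) := fun ρ => by
    rw [measureFunctional_apply, integral_transport hv hv0 hv1 ht _ φ.measurable,
      integral_regularize]
    rfl
  have hnorm := BL.norm_ofLipschitz_le hlip (norm_nonneg φ) fun x => by
    rw [abs_mul, abs_of_nonneg (regularizer_mem n x).1]
    exact (mul_le_of_le_one_left (abs_nonneg _) (regularizer_le n x)).trans (φ.abs_apply_le _)
  rw [sub_apply, hval, hval, ← sub_apply]
  refine ((ContinuousLinearMap.le_opNorm _ _).trans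
    (mul_le_mul_of_nonneg_left hnorm (norm_nonneg _))).trans_eq ?_
  rw [NNReal.coe_mk]
  ring

theorem IsRegularizedSolution.eqOn (hv : LipschitzWith K v) (hv0 : 0 < v 0) (hv1 : 0 < v 1)
    (ha : 0 ≤ a) {n : ℕ} {μ₀ : FiniteMeasure I} {ν ν' : ℝ → FiniteMeasure I}
    (h : IsRegularizedSolution v a n μ₀ ν) (h' : IsRegularizedSolution v a n μ₀ ν') :
    EqOn ν ν' (Ici 0) := by
  intro T hT
  rw [mem_Ici] at hT
  set L : ℝ := 1 + n + Real.exp (K * T)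
  have hcont : ContinuousOn (fun t => ‖measureFunctional (ν t : Measure I) -
      measureFunctional (ν' t : Measure I)‖) (Icc 0 T) :=
    ((h.continuousOn.sub h'.continuousOn).norm).mono Icc_subset_Ici_self
  have hz := eq_zero_of_le_integral (C := a * L) hT hcont (fun _ _ => norm_nonneg _) (fun t ht => by
    have h1 := (h.integrable t ht.1).smul (-a)
    have h2 := (h'.integrable t ht.1).smul (-a)
    rw [h.equation t ht.1, h'.equation t ht.1, add_sub_add_left_eq_sub]
    have h3 := intervalIntegral.integral_sub h1 h2
    simp only [Pi.smul_apply] at h3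
    rw [← h3, ← intervalIntegral.integral_const_mul]
    refine intervalIntegral.norm_integral_le_of_norm_le ht.1 (Eventually.of_forall fun s hs => ?_) ?_
    · rw [← smul_sub, norm_smul, norm_neg, Real.norm_of_nonneg ha, mul_assoc]
      exact mul_le_mul_of_nonneg_left (norm_transport_regularize_sub_le hv hv0 hv1 n _ _
        (sub_nonneg.2 hs.2) (by linarith [hs.1, ht.2])) ha
    · refine ContinuousOn.intervalIntegrable ?_
      rw [uIcc_of_le ht.1]
      exact (hcont.mono (Icc_subset_Icc_right ht.2)).const_mul _) T ⟨hT, le_rfl⟩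
  exact FiniteMeasure.toMeasure_injective (measureFunctional_injective
    (μ := (ν T : Measure I)) (ν := (ν' T : Measure I)) (sub_eq_zero.1 (norm_eq_zero.1 hz)))

/-- The dual norm does not control the mass at `1`, so Gronwall is not applied to the norm.
Evaluating the equation at `{1}` gives a closed scalar equation for the difference `d` of these
masses, and they determine the rest. -/
theorem IsLimitSolution.eqOn (ha : 0 ≤ a) {μ₀ : FiniteMeasure I} {ν ν' : ℝ → SignedMeasure I}
    (h : IsLimitSolution v a μ₀ ν) (h' : IsLimitSolution v a μ₀ ν') : EqOn ν ν' (Ici 0) := by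
  intro T hT
  rw [mem_Ici] at hT
  set d : ℝ → ℝ := fun s => ν s {1} - ν' s {1} with hd
  have hint : ∀ t, 0 ≤ t → IntervalIntegrable d volume 0 t := fun t ht =>
    (h.integrable t ht).sub (h'.integrable t ht)
  have hsub : ∀ t, 0 ≤ t → (∫ s in (0 : ℝ)..t, ν s {1}) - ∫ s in (0 : ℝ)..t, ν' s {1} =
      ∫ s in (0 : ℝ)..t, d s := fun t ht =>
    (intervalIntegral.integral_sub (h.integrable t ht) (h'.integrable t ht)).symm
  have hdeq : ∀ t, 0 ≤ t → d t = -a * ∫ s in (0 : ℝ)..t, d s := by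
    intro t ht
    rw [← hsub t ht]
    simp only [hd]
    rw [h.equation t ht, h'.equation t ht]
    simp only [sub_apply, smul_apply,
      Measure.toSignedMeasure_apply_measurable (measurableSet_singleton (1 : I)), smul_eq_mul]
    simp [Measure.real]
    ring
  -- Only integrability of `d` is given; its equation exhibits it as a primitive, hence continuous.
  have hcont : ContinuousOn d (Icc 0 T) := by
    have h1 := (intervalIntegral.continuousOn_primitive_interval (a := 0) (b := T) (f := d)
      ((intervalIntegrable_iff' ).1 (hint T hT))).const_mul (-a)
    rw [uIcc_of_le hT] at h1
    exact h1.congr fun t ht => hdeq t ht.1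
  have hz := eq_zero_of_le_integral (C := a) hT hcont.abs (fun _ _ => abs_nonneg _) (fun t ht => by
    rw [hdeq t ht.1, abs_mul, abs_neg, abs_of_nonneg ha]
    exact mul_le_mul_of_nonneg_left
      (intervalIntegral.abs_integral_le_integral_abs ht.1) ha)
  have hI : ∫ s in (0 : ℝ)..T, d s = 0 := by
    rw [intervalIntegral.integral_congr (g := fun _ => (0 : ℝ)) fun s hs => ?_]
    · simp
    · rw [uIcc_of_le hT] at hs
      exact abs_eq_zero.1 (hz s hs)
  rw [h.equation T hT, h'.equation T hT, sub_eq_zero.1 ((hsub T hT).trans hI)]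

end StickyBoundary

/-! The solutions are explicit: mass moves along the flow and is killed at rate `a f_n`, in the
limit at rate `a` on `{1}`. Since `v` is bounded below near `1`, every trajectory crosses the layer
where these rates differ in a time `O(1/n)`, so the estimate holds for every initial measure, and
the assumptions `hac` and `hsing` are not needed. -/

theorem theorem4p8 (v : I → ℝ) (hv : ∃ K : ℝ≥0, LipschitzWith K v) (hv0 : 0 < v 0) (hv1 : 0 < v 1)
    (a : ℝ) (ha : 0 ≤ a) (μ₀ : FiniteMeasure I)
    (hac : MemLp (fun x : I => ((μ₀ : Measure I).rnDeriv volume x).toReal) ∞ volume)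
    (hsing : ∀ᵐ s ∂(volume.restrict (Icc (0 : ℝ) 1)),
      Tendsto (fun m : ℕ =>
        (StickyBoundary.transport v s (StickyBoundary.singularPart μ₀) : Measure I)
          (StickyBoundary.layer m) / volume (StickyBoundary.layer m)) atTop (𝓝 0)) :
    ∃ (μn : ℕ → ℝ → FiniteMeasure I) (μ : ℝ → SignedMeasure I),
      -- `μn n` is the unique mild solution of the `n`-th regularized system
      (∀ n : ℕ, 1 ≤ n → StickyBoundary.IsRegularizedSolution v a n μ₀ (μn n) ∧
        ∀ ν, StickyBoundary.IsRegularizedSolution v a n μ₀ ν → EqOn ν (μn n) (Ici 0)) ∧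
      -- `μ` is the unique mild solution of the limit equation
      (StickyBoundary.IsLimitSolution v a μ₀ μ ∧
        ∀ ν, StickyBoundary.IsLimitSolution v a μ₀ ν → EqOn ν μ (Ici 0)) ∧
      -- the sequence is Cauchy in `C([0,T], M⁺_BL)` for every `T`
      (∀ T : ℝ, 0 < T →
        UniformCauchySeqOn
          (fun n t => StickyBoundary.measureFunctional (μn n t : Measure I)) atTop (Icc 0 T)) ∧
      -- it converges at the rate `O(1/n)`, uniformly on compact time intervals
      (∀ T : ℝ, 0 < T → ∃ C : ℝ, ∀ n : ℕ, 1 ≤ n → ∀ t ∈ Icc 0 T,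
        ‖StickyBoundary.measureFunctional (μn n t : Measure I) -
          StickyBoundary.signedFunctional (μ t)‖ ≤ C / n) := by
  obtain ⟨K, hK⟩ := hv
  -- This constant is uniform over all `t ≥ 0`, so it serves every `T`.
  obtain ⟨C, hC⟩ := StickyBoundary.exists_norm_killedTransport_sub_le hK hv0 hv1 ha μ₀
  have hlim := StickyBoundary.isLimitSolution_killedTransport hK hv0 hv1 ha μ₀
  have hreg := fun n =>
    StickyBoundary.isRegularizedSolution_killedTransport hK hv0 hv1 ha n μ₀
  refine ⟨fun n => StickyBoundary.killedTransport v a (StickyBoundary.regularizer n) μ₀,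
    fun t => (StickyBoundary.killedTransport v a StickyBoundary.boundaryIndicator μ₀ t :
      Measure I).toSignedMeasure,
    fun n _ => ⟨hreg n, fun ν hν => hν.eqOn hK hv0 hv1 ha (hreg n)⟩,
    ⟨hlim, fun ν hν => hν.eqOn ha hlim⟩, fun T _ => ?_, fun T _ => ⟨C, fun n hn t ht => ?_⟩⟩
  · refine TendstoUniformlyOn.uniformCauchySeqOn (f := fun t => StickyBoundary.measureFunctional
      (StickyBoundary.killedTransport v a StickyBoundary.boundaryIndicator μ₀ t : Measure I)) ?_
    rw [Metric.tendstoUniformlyOn_iff]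
    intro ε hε
    filter_upwards [(tendsto_const_div_atTop_nhds_zero_nat C).eventually (gt_mem_nhds hε),
      eventually_ge_atTop 1] with n hn hn1 t ht
    rw [dist_comm, dist_eq_norm]
    exact (hC n hn1 t ht.1).trans_lt hn
  · rw [StickyBoundary.signedFunctional_toSignedMeasure]
    exact hC n hn t ht.1
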